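/- Let $d \ge 1$ and let $\psi:\mathbb R^d\to\mathbb R$ be a smooth radial function with $\psi(\xi)=1$ for $|\xi|\le 1$ and $\operatorname{supp}\psi=\{|\xi|\le 5/4\}$. Put $\varphi(\xi)=\psi(\xi)-\psi(2\xi)$, $\Delta_0=\mathcal F^{-1}\psi\,\mathcal F$ and $\Delta_j=\mathcal F^{-1}\varphi(2^{-j}\cdot)\,\mathcal F$ for integers $j\ge 1$, where $\mathcal F$ is the Fourier transform with kernel $e^{-ix\cdot\xi}$. For $\lambda>1$ and $t\in\mathbb R$ let $U_\lambda(t)=e^{it\sqrt{\lambda^2-\Delta}}=\mathcal F^{-1}e^{it\sqrt{\lambda^2+|\xi|^2}}\mathcal F$. All these operators act on tempered distributions. For $2\le p\le\infty$ let $p'$ be the conjugate exponent, $1/p+1/p'=1$, and $\delta(p)=1/2-1/p$ (with $1/\infty=0$). There is a constant $C$, depending only on $d$ and $\psi$, such that for all $2\le p\le\infty$, $\theta\in[0,1]$, $\lambda>1$, $t\in\mathbb R\setminus\{0\}$, all integers $j\ge 0$ and all $f\in L^{p'}(\mathbb R^d)$, the distribution $\Delta_jU_\lambda(t)f$ belongs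 to $L^p(\mathbb R^d)$ and $$\|\Delta_jU_\lambda(t)f\|_{p}\le C\,|t|^{-(d-1+\theta)\delta(p)}\Bigl(\lambda^{(d-1+\theta)\delta(p)}\,2^{2j(1-\theta)\delta(p)}+\lambda^{-2\theta\delta(p)}\,2^{j(d+1+\theta)\delta(p)}\Bigr)\|f\|_{p'}.$$ -/

import Mathlib

open scoped ENNReal ContDiff SchwartzMap

namespace KleinGordon

/-- The Euclidean space `ℝᵈ`. -/
abbrev Space (d : ℕ) := EuclideanSpace ℝ (Fin d)

/-- The Fourier multiplier operator `𝓕⁻¹ m 𝓕` on tempered distributions, where `m` is a function of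
the angular frequency (`𝓕 f(ξ) = ∫ e^{-i x·ξ} f(x) dx` up to a constant factor), so that the symbol
`‖ξ‖²` gives `-Δ`. Mathlib's Fourier transform has the kernel `e^{-2πi x·ξ}`, hence the dilation by
`2π`. -/
noncomputable def multiplier {d : ℕ} (m : Space d → ℂ) : 𝓢'(Space d, ℂ) →L[ℂ] 𝓢'(Space d, ℂ) :=
  TemperedDistribution.fourierMultiplierCLM ℂ (fun ξ => m ((2 * Real.pi) • ξ))

/-- The symbol `exp(i t √(λ² + ‖ξ‖²))`. -/
noncomputable def propagatorSymbol {d : ℕ} (lam t : ℝ) (ξ : Space d) : ℂ :=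
  Complex.exp (Complex.I * ((t * Real.sqrt (lam ^ 2 + ‖ξ‖ ^ 2) : ℝ) : ℂ))

/-- The propagator `U_λ(t) = e^{i t √(λ² - Δ)}`. -/
noncomputable def propagator {d : ℕ} (lam t : ℝ) : 𝓢'(Space d, ℂ) →L[ℂ] 𝓢'(Space d, ℂ) :=
  multiplier (propagatorSymbol lam t)

/-- The bump functions from which the dyadic decomposition is built: smooth, radial, equal to `1` on
the closed unit ball and with support the closed ball of radius `5/4`. -/
structure IsRadialBump {d : ℕ} (ψ : Space d → ℝ) : Prop where
  smooth : ContDiff ℝ ∞ ψ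
  radial : ∀ ξ η : Space d, ‖ξ‖ = ‖η‖ → ψ ξ = ψ η
  eq_one : ∀ ξ : Space d, ‖ξ‖ ≤ 1 → ψ ξ = 1
  tsupport_eq : tsupport ψ = Metric.closedBall 0 (5 / 4)

/-- `φ(ξ) = ψ(ξ) - ψ(2ξ)`. -/
def annulusBump {d : ℕ} (ψ : Space d → ℝ) (ξ : Space d) : ℝ :=
  ψ ξ - ψ ((2 : ℝ) • ξ)

/-- The symbol of the inhomogeneous dyadic block: `ψ` for `j = 0`, and `φ(2⁻ʲ ξ)` for `j ≥ 1`. -/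
noncomputable def dyadicSymbol {d : ℕ} (ψ : Space d → ℝ) (j : ℕ) (ξ : Space d) : ℝ :=
  if j = 0 then ψ ξ else annulusBump ψ (((2 : ℝ) ^ j)⁻¹ • ξ)

/-- The dyadic decomposition operator `Δ_j`, `j ≥ 0`. -/
noncomputable def dyadicBlock {d : ℕ} (ψ : Space d → ℝ) (j : ℕ) :
    𝓢'(Space d, ℂ) →L[ℂ] 𝓢'(Space d, ℂ) :=
  multiplier (fun ξ => (dyadicSymbol ψ j ξ : ℂ))

/-- `δ(p) = 1/2 - 1/p`, with `1/∞ = 0`. -/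
noncomputable def deltaExp (p : ℝ≥0∞) : ℝ :=
  1 / 2 - (p⁻¹).toReal

/-- `x ↦ e^{ix}` has temperate growth. -/
theorem hasTemperateGrowth_exp_I : (fun x : ℝ => Complex.exp (Complex.I * (x:ℂ))).HasTemperateGrowth := by
  have hd : ∀ n : ℕ, iteratedDeriv n (fun x : ℝ => Complex.exp (Complex.I * (x:ℂ))) =
      fun x : ℝ => Complex.I ^ n * Complex.exp (Complex.I * (x:ℂ)) := by
    intro n
    induction n with
    | zero => simp
    | succ n ih =>
      rw [iteratedDeriv_succ, ih]
      ext x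
      have h : HasDerivAt (fun x : ℝ => Complex.exp (Complex.I * (x:ℂ)))
          (Complex.exp (Complex.I * (x:ℂ)) * (Complex.I * 1)) x :=
        ((Complex.ofRealCLM.hasDerivAt (x := x)).const_mul Complex.I).cexp
      rw [(h.const_mul (Complex.I ^ n)).deriv]
      ring
  refine ⟨?_, fun n => ⟨0, 1, fun x => ?_⟩⟩
  · exact (contDiff_const.mul Complex.ofRealCLM.contDiff).cexp
  · rw [norm_iteratedFDeriv_eq_norm_iteratedDeriv, hd]
    simp [mul_comm Complex.I, Complex.norm_exp_ofReal_mul_I]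

/-- The symbol of `U_λ(t)` has temperate growth, so that the multiplier is not a junk value. -/
theorem hasTemperateGrowth_propagatorSymbol {d : ℕ} {lam : ℝ} (hl : 0 < lam) (t : ℝ) :
    (fun ξ : Space d => propagatorSymbol lam t ((2 * Real.pi) • ξ)).HasTemperateGrowth := by
  have h1 : (fun ξ : Space d => (t * lam) * (1 + ‖((2 * Real.pi / lam) • ξ)‖ ^ 2) ^ (1/2 : ℝ)).HasTemperateGrowth := by
    have := (Function.hasTemperateGrowth_one_add_norm_sq_rpow (Space d) (1/2)).comp
      ((2 * Real.pi / lam) • ContinuousLinearMap.id ℝ (Space d)).hasTemperateGrowth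
    exact (Function.HasTemperateGrowth.const (t*lam)).mul this
  have h2 := hasTemperateGrowth_exp_I.comp h1
  convert h2 using 2 with ξ
  simp only [propagatorSymbol, Function.comp]
  congr 3
  rw [← Real.sqrt_eq_rpow, mul_assoc, norm_smul, norm_smul]
  congr 1
  rw [show lam^2 + (‖2*Real.pi‖*‖ξ‖)^2 = lam^2 * (1 + (‖2*Real.pi/lam‖*‖ξ‖)^2) by
    rw [norm_div, Real.norm_of_nonneg hl.le]; field_simp]
  rw [Real.sqrt_mul (by positivity), Real.sqrt_sq hl.le]

/-- The symbol of `Δ_j` has temperate growth, so that the multiplier is not a junk value. -/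
theorem hasTemperateGrowth_dyadicSymbol {d : ℕ} {ψ : Space d → ℝ} (h : IsRadialBump ψ) (j : ℕ) :
    (fun ξ : Space d => ((dyadicSymbol ψ j ((2 * Real.pi) • ξ) : ℝ) : ℂ)).HasTemperateGrowth := by
  have h0 : ψ.HasTemperateGrowth := by
    apply HasCompactSupport.hasTemperateGrowth _ h.smooth
    rw [HasCompactSupport, h.tsupport_eq]; exact isCompact_closedBall _ _
  have h1 : ∀ c : ℝ, (fun ξ : Space d => ψ (c • ξ)).HasTemperateGrowth := fun c =>
    h0.comp (c • ContinuousLinearMap.id ℝ (Space d)).hasTemperateGrowth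
  refine Function.Complex.hasTemperateGrowth_ofReal.comp (f := fun ξ => dyadicSymbol ψ j ((2 * Real.pi) • ξ)) ?_
  unfold dyadicSymbol annulusBump
  split_ifs
  · exact h1 _
  · simp only [smul_smul]
    exact (h1 _).sub (h1 _)

end KleinGordon

/-! The estimate is interpolated between the bound `L² → L²`, where the symbol of `Δ_j U_λ(t)` is
bounded uniformly in all parameters, and the bound `L¹ → L^∞`, where the supremum of the convolution
kernel is needed. Interpolating with weight `2δ(p)` raises the kernel bound to that power, and
subadditivity of `x ↦ x ^ (2δ(p))` separates its two terms.

The kernel is estimated without stationary phase. Put `N = 2 ^ j`, `L = √(λ² + N²)`, `μ = λ / L`, `ν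
= N / L`. After rescaling, the kernel is at most `N ^ d` times an oscillatory integral with phase `τ
S(η)`, where `τ = t L` and `S(η) = √(μ² + ν² ‖η‖²)`. With `α = 1 - i τ / 2` one has `exp (i τ S) =
exp (2 S) exp (-2 α S)`. The factor `exp (2 S)` joins the cutoff to form a smooth compactly
supported function of `(μ, η)` jointly. Fourier inversion in `(μ, η)` then reduces everything to the
Fourier transform of `exp (-2 α S)`, uniformly in the parameters (`exists_norm_oscillatory_le`).

That transform is explicit: subordinating the exponential to Gaussians gives a modified Bessel
integral (`expSqrtTransform_eq`). Such an integral is bounded trivially, and also by a constant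
times `‖B‖ ^ (-1/2)` in its second parameter (`exists_norm_besselIntegral_le`); the latter comes
from the closed form at half-integer order. The kernel bounds are therefore `L ^ d (|t| L) ^ ((1 -
d) / 2)` and `L ^ d (|t| L) ^ (-d / 2) L / λ`, besides the trivial `N ^ d`, up to constants.
`dispersive_interpolation` takes geometric means of these, separately for `N ≤ λ` and `λ ≤ N`.

The passage to `L^p` is `riesz_thorin`: the three lines theorem for finite matrices, applied to step
functions, followed by duality and density. -/

namespace KleinGordon

open MeasureTheory Set Filter Topology

/-! ### Modified Bessel integrals: differentiation in `B` and integration by parts. -/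

/-- The integrand `m ^ s * exp (-A m - B / m)` of the modified Bessel integral. -/
noncomputable def besselIntegrand (s : ℝ) (A B : ℂ) (m : ℝ) : ℂ :=
  ((m ^ s : ℝ) : ℂ) * Complex.exp (-(A * m) - B / m)

/-- The modified Bessel integral `∫₀^∞ m ^ s * exp (-A m - B / m) dm`. -/
noncomputable def besselIntegral (s : ℝ) (A B : ℂ) : ℂ :=
  ∫ m in Ioi (0 : ℝ), besselIntegrand s A B m

theorem norm_besselIntegrand (s : ℝ) (A B : ℂ) {m : ℝ} (hm : 0 < m) :
    ‖besselIntegrand s A B m‖ = m ^ s * Real.exp (-(A.re * m) - B.re / m) := by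
  rw [besselIntegrand, norm_mul, Complex.norm_exp, Complex.norm_real,
    Real.norm_of_nonneg (by positivity)]
  congr 2
  simp [Complex.div_ofReal_re]

theorem measurable_besselIntegrand (s : ℝ) (A B : ℂ) : Measurable (besselIntegrand s A B) := by
  unfold besselIntegrand
  fun_prop

/-- Near zero, `exp (-b / m) ≤ n! (m / b) ^ n` absorbs any negative power of `m`, so no restriction
on `s` is needed. -/
theorem integrableOn_rpow_mul_exp (s : ℝ) {a b : ℝ} (ha : 0 < a) (hb : 0 < b) :
    IntegrableOn (fun m : ℝ => m ^ s * Real.exp (-(a * m) - b / m)) (Ioi 0) := by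
  obtain ⟨n, hn⟩ := exists_nat_gt (-s)
  have h1 : IntegrableOn (fun m : ℝ => (n.factorial / b ^ n) *
      (m ^ (s + n) * Real.exp (-a * m ^ (1 : ℝ)))) (Ioi 0) :=
    (integrableOn_rpow_mul_exp_neg_mul_rpow (by linarith) one_pos ha).const_mul _
  refine h1.mono' (by fun_prop) ?_
  filter_upwards [ae_restrict_mem measurableSet_Ioi] with m hm
  have hm : 0 < m := hm
  rw [Real.norm_of_nonneg (by positivity), Real.rpow_add hm, Real.rpow_natCast, Real.rpow_one,
    sub_eq_add_neg, Real.exp_add, neg_mul]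
  have h2 := Real.pow_div_factorial_le_exp (b / m) (by positivity) n
  have h3 : Real.exp (-(b / m)) ≤ n.factorial / b ^ n * m ^ n := by
    rw [Real.exp_neg]
    refine (inv_anti₀ (by positivity) h2).trans (le_of_eq ?_)
    rw [div_pow]
    field_simp
  calc m ^ s * (Real.exp (-(a * m)) * Real.exp (-(b / m)))
      ≤ m ^ s * (Real.exp (-(a * m)) * (n.factorial / b ^ n * m ^ n)) := by gcongr
    _ = _ := by ring

theorem integrableOn_besselIntegrand (s : ℝ) {A B : ℂ} (hA : 0 < A.re) (hB : 0 < B.re) :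
    IntegrableOn (besselIntegrand s A B) (Ioi 0) := by
  refine (integrableOn_rpow_mul_exp s hA hB).mono'
    (measurable_besselIntegrand s A B).aestronglyMeasurable ?_
  filter_upwards [ae_restrict_mem measurableSet_Ioi] with m hm
  exact (norm_besselIntegrand s A B hm).le

theorem hasDerivAt_besselIntegral (s : ℝ) {A B : ℂ} (hA : 0 < A.re) (hB : 0 < B.re) :
    HasDerivAt (besselIntegral s A) (-besselIntegral (s - 1) A B) B := by
  have key := hasDerivAt_integral_of_dominated_loc_of_deriv_le (𝕜 := ℂ)
    (μ := volume.restrict (Ioi (0 : ℝ))) (F := fun B m => besselIntegrand s A B m)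
    (F' := fun B m => -besselIntegrand (s - 1) A B m) (x₀ := B)
    (bound := fun m => m ^ (s - 1) * Real.exp (-(A.re * m) - (B.re / 2) / m))
    -- On this half-plane `exp (-z / m)` is dominated by `exp (-(B.re / 2) / m)`, which keeps the
    -- strong decay at `m = 0`.
    (s := {z : ℂ | B.re / 2 < z.re})
    ((isOpen_lt continuous_const Complex.continuous_re).mem_nhds (by simp; linarith))
    (Eventually.of_forall fun z => (measurable_besselIntegrand s A z).aestronglyMeasurable)
    (integrableOn_besselIntegrand s hA hB)
    (measurable_besselIntegrand (s - 1) A B).neg.aestronglyMeasurable ?_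
    (integrableOn_rpow_mul_exp (s - 1) hA (by linarith)) ?_
  · have := key.2
    rwa [integral_neg] at this
  · filter_upwards [ae_restrict_mem measurableSet_Ioi] with m hm z hz
    have hm : 0 < m := hm
    rw [norm_neg, norm_besselIntegrand _ _ _ hm]
    have hz : B.re / 2 < z.re := hz
    gcongr
  · filter_upwards [ae_restrict_mem measurableSet_Ioi] with m hm z hz
    have hm : 0 < m := hm
    unfold besselIntegrand
    have h1 : HasDerivAt (fun z : ℂ => -(A * m) - z / m) (-(1 / (m : ℂ))) z := by
      simpa using ((hasDerivAt_id z).div_const (m : ℂ)).const_sub (-(A * m))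
    have h2 := (h1.cexp).const_mul (((m ^ s : ℝ) : ℂ))
    refine h2.congr_deriv ?_
    rw [Real.rpow_sub_one hm.ne']
    push_cast
    ring

theorem tendsto_rpow_mul_exp_nhdsGT_zero (s : ℝ) {a b : ℝ} (ha : 0 < a) (hb : 0 < b) :
    Tendsto (fun m : ℝ => m ^ s * Real.exp (-(a * m) - b / m)) (𝓝[>] 0) (𝓝 0) := by
  have h := (tendsto_rpow_mul_exp_neg_mul_atTop_nhds_zero (-s) b hb).comp tendsto_inv_nhdsGT_zero
  refine squeeze_zero' ?_ ?_ h
  · filter_upwards [self_mem_nhdsWithin] with m hm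
    have hm : 0 < m := hm
    positivity
  · filter_upwards [self_mem_nhdsWithin] with m hm
    have hm : 0 < m := hm
    simp only [Function.comp]
    rw [Real.rpow_neg (by positivity), Real.inv_rpow hm.le, inv_inv]
    gcongr
    have : 0 < a * m := by positivity
    rw [div_eq_mul_inv]
    linarith

theorem tendsto_rpow_mul_exp_atTop_zero (s : ℝ) {a b : ℝ} (ha : 0 < a) (hb : 0 ≤ b) :
    Tendsto (fun m : ℝ => m ^ s * Real.exp (-(a * m) - b / m)) atTop (𝓝 0) := by
  have h := (tendsto_rpow_mul_exp_neg_mul_atTop_nhds_zero s a ha)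
  refine squeeze_zero' ?_ ?_ h
  · filter_upwards [eventually_gt_atTop 0] with m hm
    positivity
  · filter_upwards [eventually_gt_atTop 0] with m hm
    gcongr
    have : 0 ≤ b / m := by positivity
    linarith

theorem hasDerivAt_besselIntegrand (s : ℝ) (A B : ℂ) {m : ℝ} (hm : 0 < m) :
    HasDerivAt (besselIntegrand s A B) (s * besselIntegrand (s - 1) A B m -
      A * besselIntegrand s A B m + B * besselIntegrand (s - 2) A B m) m := by
  have h1 : HasDerivAt (fun m : ℝ => ((m ^ s : ℝ) : ℂ)) ((s * m ^ (s - 1) : ℝ) : ℂ) m :=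
    (Real.hasDerivAt_rpow_const (Or.inl hm.ne')).ofReal_comp
  have hmc : (m : ℂ) ≠ 0 := by exact_mod_cast hm.ne'
  have h2 : HasDerivAt (fun m : ℝ => -(A * m) - B / m) (-A + B / (m : ℂ) ^ 2) m := by
    have h0 : HasDerivAt (fun m : ℝ => (m : ℂ)) 1 m := Complex.ofRealCLM.hasDerivAt
    have h3 := (h0.const_mul A).neg.sub ((hasDerivAt_const m B).div h0 hmc)
    refine h3.congr_deriv ?_
    field_simp
    ring
  have h4 := h1.mul h2.cexp
  have e : s - 2 = s - 1 - 1 := by ring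
  unfold besselIntegrand
  refine h4.congr_deriv ?_
  rw [e, Real.rpow_sub_one hm.ne' (s - 1), Real.rpow_sub_one hm.ne']
  push_cast
  field_simp
  ring

theorem integral_Ioi_eq_zero_of_hasDerivAt {f f' : ℝ → ℂ} {a : ℝ}
    (hderiv : ∀ x ∈ Ioi a, HasDerivAt f (f' x) x) (hint : IntegrableOn f' (Ioi a))
    (h_zero : Tendsto f (𝓝[>] a) (𝓝 0)) (h_infty : Tendsto f atTop (𝓝 0)) :
    ∫ x in Ioi a, f' x = 0 := by
  -- The product form with `v = 1` involves only the one-sided limit of `f` at `a`, never the value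
  -- `f a`.
  have := integral_Ioi_deriv_mul_eq_sub (u := f) (u' := f') (v := fun _ => 1) (v' := fun _ => 0)
    (a' := 0) (b' := 0) hderiv (fun x _ => hasDerivAt_const x 1)
    (by simpa [Pi.mul_def, Pi.add_def] using hint) (by simpa [Pi.mul_def] using h_zero)
    (by simpa [Pi.mul_def] using h_infty)
  simpa using this

/-- Integration by parts for the modified Bessel integral. -/
theorem besselIntegral_recurrence (s : ℝ) {A B : ℂ} (hA : 0 < A.re) (hB : 0 < B.re) :
    s * besselIntegral (s - 1) A B - A * besselIntegral s A B +
      B * besselIntegral (s - 2) A B = 0 := by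
  have i0 := integrableOn_besselIntegrand s hA hB
  have i1 := integrableOn_besselIntegrand (s - 1) hA hB
  have i2 := integrableOn_besselIntegrand (s - 2) hA hB
  have key := integral_Ioi_eq_zero_of_hasDerivAt (a := (0:ℝ))
    (f := besselIntegrand s A B) (fun m hm => hasDerivAt_besselIntegrand s A B hm)
    (((i1.const_mul (s : ℂ)).sub (i0.const_mul A)).add (i2.const_mul B)) ?_ ?_
  · rw [integral_add, integral_sub, integral_const_mul, integral_const_mul, integral_const_mul]
      at key
    · exact key
    · exact i1.const_mul _
    · exact i0.const_mul _
    · exact (i1.const_mul _).sub (i0.const_mul _)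
    · exact i2.const_mul _
  · rw [tendsto_zero_iff_norm_tendsto_zero]
    refine (tendsto_rpow_mul_exp_nhdsGT_zero s hA hB).congr' ?_
    filter_upwards [self_mem_nhdsWithin] with m hm
    exact (norm_besselIntegrand s A B hm).symm
  · rw [tendsto_zero_iff_norm_tendsto_zero]
    refine (tendsto_rpow_mul_exp_atTop_zero s hA hB.le).congr' ?_
    filter_upwards [eventually_gt_atTop 0] with m hm
    exact (norm_besselIntegrand s A B hm).symm

/-! ### Square roots in the right half-plane and the Bessel integral of half-integer order. -/

theorem cpow_half_mul_self (z : ℂ) : z ^ (1 / 2 : ℂ) * z ^ (1 / 2 : ℂ) = z := by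
  rw [← pow_two, ← Complex.cpow_ofNat_mul]
  simp

theorem re_cpow_half_pos {z : ℂ} (hz : 0 < z.re) : 0 < (z ^ (1 / 2 : ℂ)).re := by
  have hz0 : z ≠ 0 := by rintro rfl; simp at hz
  rw [Complex.cpow_def_of_ne_zero hz0, Complex.exp_re]
  have h1 := Complex.abs_arg_lt_pi_div_two_iff.2 (Or.inl hz)
  have h2 := abs_lt.1 h1
  refine mul_pos (Real.exp_pos _) (Real.cos_pos_of_mem_Ioo ⟨?_, ?_⟩)
  · simp [Complex.mul_im, Complex.log_im]; linarith [Real.pi_pos]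
  · simp [Complex.mul_im, Complex.log_im]; linarith [Real.pi_pos]

/-- Each square root lies in the sector `|Im| ≤ Re`, so the product stays in the closed right
half-plane. -/
theorem re_mul_cpow_half_nonneg {z w : ℂ} (hz : 0 < z.re) (hw : 0 < w.re) :
    0 ≤ (z ^ (1 / 2 : ℂ) * w ^ (1 / 2 : ℂ)).re := by
  have key : ∀ {u : ℂ}, 0 < u.re → |(u ^ (1 / 2 : ℂ)).im| ≤ (u ^ (1 / 2 : ℂ)).re := by
    intro u hu
    have h1 := cpow_half_mul_self u
    have h2 := re_cpow_half_pos hu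
    refine abs_le_of_sq_le_sq ?_ h2.le
    have h3 := congrArg Complex.re h1
    rw [Complex.mul_re] at h3
    nlinarith
  rw [Complex.mul_re]
  have h1 := mul_le_mul (key hz) (key hw) (abs_nonneg _) (re_cpow_half_pos hz).le
  rw [← abs_mul] at h1
  linarith [le_abs_self ((z ^ (1 / 2 : ℂ)).im * (w ^ (1 / 2 : ℂ)).im)]

theorem norm_cpow_half (z : ℂ) : ‖z ^ (1 / 2 : ℂ)‖ = Real.sqrt ‖z‖ := by
  rw [eq_comm, Real.sqrt_eq_iff_mul_self_eq (norm_nonneg _) (norm_nonneg _), ← norm_mul,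
    cpow_half_mul_self]

theorem hasDerivAt_cpow_half {z : ℂ} (hz : 0 < z.re) :
    HasDerivAt (fun z : ℂ => z ^ (1 / 2 : ℂ)) (1 / (2 * z ^ (1 / 2 : ℂ))) z := by
  have hz0 : z ≠ 0 := by rintro rfl; simp at hz
  have h := (hasDerivAt_id z).cpow_const (c := (1 / 2 : ℂ)) (Or.inl hz)
  refine h.congr_deriv ?_
  rw [id, mul_one]
  have h1 : z ^ (1 / 2 : ℂ) ≠ 0 := by
    rw [Ne, Complex.cpow_eq_zero_iff]; tauto
  rw [Complex.cpow_sub _ _ hz0, Complex.cpow_one]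
  have h2 := cpow_half_mul_self z
  set b := z ^ (1 / 2 : ℂ)
  rw [← h2]
  field_simp

theorem isOpen_re_pos : IsOpen {z : ℂ | 0 < z.re} := isOpen_lt continuous_const Complex.continuous_re

theorem isPreconnected_re_pos : IsPreconnected {z : ℂ | 0 < z.re} :=
  (convex_halfSpace_re_gt 0).isPreconnected

theorem norm_besselIntegral_le (s : ℝ) {A B B' : ℂ} (hA : 0 < A.re) (hB : 0 < B.re)
    (h : B.re ≤ B'.re) : ‖besselIntegral s A B'‖ ≤
      ∫ m in Ioi (0 : ℝ), m ^ s * Real.exp (-(A.re * m) - B.re / m) := by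
  refine norm_integral_le_of_norm_le (integrableOn_rpow_mul_exp s hA hB) ?_
  filter_upwards [ae_restrict_mem measurableSet_Ioi] with m hm
  have hm : 0 < m := hm
  rw [norm_besselIntegrand _ _ _ hm]
  gcongr

/-- The quotient of the modified Bessel functions of order `1/2` and `-1/2`. -/
theorem cpow_half_mul_besselIntegral {A B : ℂ} (hA : 0 < A.re) (hB : 0 < B.re) :
    B ^ (1 / 2 : ℂ) * besselIntegral (-3 / 2) A B =
      A ^ (1 / 2 : ℂ) * besselIntegral (-1 / 2) A B := by
  set σ := A ^ (1 / 2 : ℂ) with hσ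
  have hσre : 0 < σ.re := re_cpow_half_pos hA
  have hσ2 : σ * σ = A := cpow_half_mul_self A
  let D : ℂ → ℂ := fun z => z ^ (1 / 2 : ℂ) * besselIntegral (-3 / 2) A z -
    σ * besselIntegral (-1 / 2) A z
  -- The recurrence at `s = -1/2` yields `D' = (σ / √z) D`, so `D` is a constant times `exp (2 σ
  -- √z)` and `E` is that constant.
  let E : ℂ → ℂ := fun z => D z * Complex.exp (-2 * σ * z ^ (1 / 2 : ℂ))
  have hE : ∀ z : ℂ, 0 < z.re → HasDerivAt E 0 z := by
    intro z hz
    have h1 := hasDerivAt_besselIntegral (-3 / 2) hA hz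
    have h2 := hasDerivAt_besselIntegral (-1 / 2) hA hz
    have h3 := hasDerivAt_cpow_half hz
    have h4 := besselIntegral_recurrence (-1 / 2) hA hz
    rw [show (-1 / 2 - 1 : ℝ) = -3 / 2 by norm_num] at h2 h4
    rw [show (-3 / 2 - 1 : ℝ) = -5 / 2 by norm_num] at h1
    rw [show (-1 / 2 - 2 : ℝ) = -5 / 2 by norm_num] at h4
    have h5 := ((h3.mul h1).sub (h2.const_mul σ)).mul ((h3.const_mul (-2 * σ)).cexp)
    refine h5.congr_deriv ?_
    have hb : z ^ (1 / 2 : ℂ) ≠ 0 := by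
      intro h0; have := re_cpow_half_pos hz; rw [h0] at this; simp at this
    have hb2 := cpow_half_mul_self z
    set b := z ^ (1 / 2 : ℂ)
    set P := besselIntegral (-3 / 2) A z
    set Q := besselIntegral (-1 / 2) A z
    set R := besselIntegral (-5 / 2) A z
    set e := Complex.exp (-2 * σ * b)
    push_cast at h4
    have hR : R = (P / 2 + σ * σ * Q) / (b * b) := by
      rw [eq_div_iff (mul_ne_zero hb hb), hσ2, hb2]
      linear_combination h4
    rw [hR]
    change (1 / (2 * b) * P + b * -((P / 2 + σ * σ * Q) / (b * b)) - σ * -P) * e +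
      (b * P - σ * Q) * (e * (-2 * σ * (1 / (2 * b)))) = 0
    field_simp
    ring
  obtain ⟨c, hc⟩ := isOpen_re_pos.exists_is_const_of_deriv_eq_zero (f := E) isPreconnected_re_pos
    (fun z hz => (hE z hz).differentiableAt.differentiableWithinAt) (fun z hz => (hE z hz).deriv)
  set p := ∫ m in Ioi (0 : ℝ), m ^ (-3 / 2 : ℝ) * Real.exp (-(A.re * m) - (1 : ℂ).re / m)
  set q := ∫ m in Ioi (0 : ℝ), m ^ (-1 / 2 : ℝ) * Real.exp (-(A.re * m) - (1 : ℂ).re / m)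
  -- Along `z = x²` the two integrals stay bounded, so `D` grows at most linearly while the
  -- exponential factor in `E` decays; the constant must vanish.
  have hbound : ∀ x : ℝ, 1 ≤ x → ‖c‖ ≤ p * (x ^ (1 : ℝ) * Real.exp (-(2 * σ.re) * x)) +
      ‖σ‖ * q * (x ^ (0 : ℝ) * Real.exp (-(2 * σ.re) * x)) := by
    intro x hx
    have hx2 : 0 < ((x ^ 2 : ℝ) : ℂ).re := by rw [Complex.ofReal_re]; positivity
    have hsq : ((x ^ 2 : ℝ) : ℂ) ^ (1 / 2 : ℂ) = x := by
      rw [show (1 / 2 : ℂ) = ((1 / 2 : ℝ) : ℂ) by push_cast; rfl,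
        ← Complex.ofReal_cpow (by positivity), ← Real.sqrt_eq_rpow, Real.sqrt_sq (by linarith)]
    rw [← hc _ hx2]
    simp only [E, D, norm_mul, Complex.norm_exp, hsq]
    have h1 : (1 : ℂ).re ≤ ((x ^ 2 : ℝ) : ℂ).re := by
      rw [Complex.ofReal_re, Complex.one_re]; nlinarith
    have hp := norm_besselIntegral_le (-3 / 2) (B := 1) hA (by simp) h1
    have hq := norm_besselIntegral_le (-1 / 2) (B := 1) hA (by simp) h1
    have he : (-2 * σ * (x : ℂ)).re = -(2 * σ.re) * x := by simp
    rw [he, Real.rpow_one, Real.rpow_zero, one_mul, ← mul_assoc, ← add_mul]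
    gcongr
    refine (norm_sub_le _ _).trans ?_
    rw [norm_mul, norm_mul, Complex.norm_real, Real.norm_of_nonneg (by linarith), mul_comm p]
    gcongr
  have hlim : Tendsto (fun x : ℝ => p * (x ^ (1 : ℝ) * Real.exp (-(2 * σ.re) * x)) +
      ‖σ‖ * q * (x ^ (0 : ℝ) * Real.exp (-(2 * σ.re) * x))) atTop (𝓝 0) := by
    have h1 := (tendsto_rpow_mul_exp_neg_mul_atTop_nhds_zero 1 (2 * σ.re) (by linarith)).const_mul p
    have h2 := (tendsto_rpow_mul_exp_neg_mul_atTop_nhds_zero 0 (2 * σ.re)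
      (by linarith)).const_mul (‖σ‖ * q)
    simpa using h1.add h2
  have hc0 : ‖c‖ ≤ 0 := ge_of_tendsto hlim (by
    filter_upwards [eventually_ge_atTop 1] with x hx using hbound x hx)
  have := hc B hB
  rw [norm_le_zero_iff.1 hc0] at this
  exact sub_eq_zero.1 ((mul_eq_zero.1 this).resolve_right (Complex.exp_ne_zero _))

theorem integral_rpow_neg_half_mul_cexp {A : ℂ} (hA : 0 < A.re) :
    ∫ m in Ioi (0 : ℝ), besselIntegrand (-1 / 2) A 0 m = (Real.pi / A) ^ (1 / 2 : ℂ) := by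
  -- The substitution `m = x²` turns the integral into a Gaussian one.
  rw [← integral_comp_rpow_Ioi_of_pos (g := besselIntegrand (-1 / 2) A 0) (p := 2) two_pos]
  have h1 := integral_gaussian_complex_Ioi hA
  have h2 : (Real.pi / A : ℂ) ^ (1 / 2 : ℂ) = 2 * ∫ x in Ioi (0 : ℝ), Complex.exp (-A * x ^ 2) := by
    rw [h1]; ring
  rw [h2, ← integral_const_mul]
  refine setIntegral_congr_fun measurableSet_Ioi fun x hx => ?_
  have hx : 0 < x := hx
  simp only [besselIntegrand]
  rw [← Real.rpow_mul hx.le]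
  norm_num
  rw [Real.rpow_neg hx.le, Real.rpow_one]
  push_cast
  have hxc : (x : ℂ) ≠ 0 := by exact_mod_cast hx.ne'
  field_simp

/-- The modified Bessel function of order `1/2` in closed form. -/
theorem besselIntegral_neg_half {A B : ℂ} (hA : 0 < A.re) (hB : 0 < B.re) :
    besselIntegral (-1 / 2) A B = (Real.pi / A) ^ (1 / 2 : ℂ) *
      Complex.exp (-2 * (A ^ (1 / 2 : ℂ) * B ^ (1 / 2 : ℂ))) := by
  set σ := A ^ (1 / 2 : ℂ) with hσ
  -- By `cpow_half_mul_besselIntegral` the integral `Q` of order `-1/2` satisfies `Q' = -(σ / √z)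
  -- Q`, so `E` is constant; its value is read off as `z → 0⁺`, where `Q` tends to the Gaussian
  -- integral.
  let E : ℂ → ℂ := fun z => besselIntegral (-1 / 2) A z * Complex.exp (2 * σ * z ^ (1 / 2 : ℂ))
  have hE : ∀ z : ℂ, 0 < z.re → HasDerivAt E 0 z := by
    intro z hz
    have h2 := hasDerivAt_besselIntegral (-1 / 2) hA hz
    have h3 := hasDerivAt_cpow_half hz
    have h4 := cpow_half_mul_besselIntegral hA hz
    rw [show (-1 / 2 - 1 : ℝ) = -3 / 2 by norm_num] at h2
    refine (h2.mul ((h3.const_mul (2 * σ)).cexp)).congr_deriv ?_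
    have hb : z ^ (1 / 2 : ℂ) ≠ 0 := by
      intro h0; have := re_cpow_half_pos hz; rw [h0] at this; simp at this
    rw [← hσ] at h4
    set b := z ^ (1 / 2 : ℂ)
    set P := besselIntegral (-3 / 2) A z
    set Q := besselIntegral (-1 / 2) A z
    set e := Complex.exp (2 * σ * b)
    have h5 : 2 * σ * (1 / (2 * b)) = σ / b := by field_simp
    rw [h5]
    have h6 : P = σ * Q / b := by rw [eq_div_iff hb, ← h4]; ring
    rw [h6]
    ring
  obtain ⟨c, hc⟩ := isOpen_re_pos.exists_is_const_of_deriv_eq_zero (f := E) isPreconnected_re_pos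
    (fun z hz => (hE z hz).differentiableAt.differentiableWithinAt) (fun z hz => (hE z hz).deriv)
  have hQ : Tendsto (fun x : ℝ => besselIntegral (-1 / 2) A x) (𝓝[>] 0)
      (𝓝 ((Real.pi / A) ^ (1 / 2 : ℂ))) := by
    rw [← integral_rpow_neg_half_mul_cexp hA]
    refine tendsto_integral_filter_of_dominated_convergence
      (fun m => m ^ (-1 / 2 : ℝ) * Real.exp (-A.re * m ^ (1 : ℝ)))
      (Eventually.of_forall fun x => (measurable_besselIntegrand _ A _).aestronglyMeasurable)
      ?_ (integrableOn_rpow_mul_exp_neg_mul_rpow (by norm_num) one_pos hA) ?_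
    · filter_upwards [self_mem_nhdsWithin] with x hx
      have hx : 0 < x := hx
      filter_upwards [ae_restrict_mem measurableSet_Ioi] with m hm
      have hm : 0 < m := hm
      rw [norm_besselIntegrand _ _ _ hm, Complex.ofReal_re, Real.rpow_one]
      gcongr
      have : 0 < x / m := by positivity
      linarith
    · filter_upwards with m
      have h : Continuous fun x : ℝ => besselIntegrand (-1 / 2) A x m := by
        unfold besselIntegrand; fun_prop
      simpa using (h.tendsto 0).mono_left nhdsWithin_le_nhds
  have hX : Tendsto (fun x : ℝ => Complex.exp (2 * σ * (x : ℂ) ^ (1 / 2 : ℂ))) (𝓝[>] 0) (𝓝 1) := by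
    have h1 : Tendsto (fun x : ℝ => Complex.exp (2 * σ * ((x ^ (1 / 2 : ℝ) : ℝ) : ℂ))) (𝓝 0)
        (𝓝 (Complex.exp (2 * σ * (((0 : ℝ) ^ (1 / 2 : ℝ) : ℝ) : ℂ)))) := by
      have : ContinuousAt (fun x : ℝ => x ^ (1 / 2 : ℝ)) 0 :=
        Real.continuousAt_rpow_const _ _ (Or.inr (by norm_num))
      exact ((Complex.continuous_exp.comp (continuous_const.mul
        Complex.continuous_ofReal)).continuousAt.comp this)
    rw [Real.zero_rpow (by norm_num)] at h1
    simp only [Complex.ofReal_zero, mul_zero, Complex.exp_zero] at h1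
    refine (h1.mono_left nhdsWithin_le_nhds).congr' ?_
    filter_upwards [self_mem_nhdsWithin] with x hx
    have hx : 0 < x := hx
    rw [Complex.ofReal_cpow hx.le]
    push_cast
    rfl
  have hlim : Tendsto (fun x : ℝ => E x) (𝓝[>] 0) (𝓝 ((Real.pi / A) ^ (1 / 2 : ℂ))) := by
    simpa only [mul_one] using hQ.mul hX
  have hcE : (fun x : ℝ => E x) =ᶠ[𝓝[>] 0] fun _ => c := by
    filter_upwards [self_mem_nhdsWithin] with x hx
    exact hc x (by simpa using hx)
  have hc' : c = (Real.pi / A) ^ (1 / 2 : ℂ) :=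
    tendsto_nhds_unique ((tendsto_congr' hcE).2 tendsto_const_nhds) hlim
  rw [← hc', ← hc B hB]
  simp only [E]
  rw [mul_assoc, ← Complex.exp_add]
  simp [mul_assoc]

/-- In `√B · I(-3/2) = √A · I(-1/2)` the factor `√A` cancels against the closed form, and the
remaining exponential has modulus at most one. The bound is thus independent of `A`, in particular
of its imaginary part. -/
theorem norm_besselIntegral_neg_three_half_le {A B : ℂ} (hA : 0 < A.re) (hB : 0 < B.re) :
    ‖besselIntegral (-3 / 2) A B‖ ≤ Real.sqrt Real.pi / Real.sqrt ‖B‖ := by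
  have hB0 : 0 < ‖B‖ := norm_pos_iff.2 (by rintro rfl; simp at hB)
  have hA0 : 0 < ‖A‖ := norm_pos_iff.2 (by rintro rfl; simp at hA)
  have h := congrArg norm (cpow_half_mul_besselIntegral hA hB)
  rw [besselIntegral_neg_half hA hB] at h
  simp only [norm_mul, norm_cpow_half, Complex.norm_exp, norm_div, Complex.norm_real,
    Real.norm_of_nonneg Real.pi_pos.le, Real.sqrt_div Real.pi_pos.le] at h
  rw [le_div_iff₀ (Real.sqrt_pos.2 hB0), mul_comm, h, ← mul_assoc,
    mul_div_cancel₀ _ (Real.sqrt_pos.2 hA0).ne']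
  refine mul_le_of_le_one_right (Real.sqrt_nonneg _) (Real.exp_le_one_iff.2 ?_)
  have := re_mul_cpow_half_nonneg hA hB
  simp only [Complex.mul_re] at this ⊢
  norm_num
  linarith

/-! ### Decay in `B` for every order `s > -1/2`, by Fourier analysis of a Gamma density. -/

theorem integrableOn_rpow_mul_exp_neg {s a : ℝ} (hs : -1 < s) (ha : 0 < a) :
    IntegrableOn (fun m : ℝ => m ^ s * Real.exp (-(a * m))) (Ioi 0) := by
  simpa using integrableOn_rpow_mul_exp_neg_mul_rpow hs one_pos ha

theorem norm_besselIntegrand_zero (s : ℝ) (A : ℂ) {m : ℝ} (hm : 0 < m) :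
    ‖besselIntegrand s A 0 m‖ = m ^ s * Real.exp (-(A.re * m)) := by
  simp [norm_besselIntegrand s A 0 hm]

theorem integrableOn_besselIntegrand_zero {s : ℝ} {A : ℂ} (hs : -1 < s) (hA : 0 < A.re) :
    IntegrableOn (besselIntegrand s A 0) (Ioi 0) := by
  refine (integrableOn_rpow_mul_exp_neg hs hA).mono'
    (measurable_besselIntegrand s A 0).aestronglyMeasurable ?_
  filter_upwards [ae_restrict_mem measurableSet_Ioi] with m hm
  exact (norm_besselIntegrand_zero s A hm).le

theorem besselIntegral_zero_recurrence {s : ℝ} {A : ℂ} (hs : 0 < s) (hA : 0 < A.re) :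
    A * besselIntegral s A 0 = s * besselIntegral (s - 1) A 0 := by
  have i0 := integrableOn_besselIntegrand_zero (s := s) (by linarith) hA
  have i1 := integrableOn_besselIntegrand_zero (s := s - 1) (by linarith) hA
  have key := integral_Ioi_eq_zero_of_hasDerivAt (a := (0:ℝ))
    (f := besselIntegrand s A 0) (f' := fun m => s * besselIntegrand (s - 1) A 0 m -
      A * besselIntegrand s A 0 m)
    (fun m hm => by simpa using hasDerivAt_besselIntegrand s A 0 hm)
    ((i1.const_mul (s : ℂ)).sub (i0.const_mul A)) ?_ ?_
  · rw [integral_sub, integral_const_mul, integral_const_mul, sub_eq_zero] at key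
    · exact key.symm
    · exact i1.const_mul _
    · exact i0.const_mul _
  · rw [tendsto_zero_iff_norm_tendsto_zero]
    have h : Tendsto (fun m : ℝ => m ^ s * Real.exp (-(A.re * m))) (𝓝 0) (𝓝 0) := by
      have : ContinuousAt (fun m : ℝ => m ^ s * Real.exp (-(A.re * m))) 0 :=
        (Real.continuousAt_rpow_const _ _ (Or.inr hs.le)).mul (by fun_prop)
      simpa [ContinuousAt, Real.zero_rpow hs.ne'] using this
    refine (h.mono_left nhdsWithin_le_nhds).congr' ?_
    filter_upwards [self_mem_nhdsWithin] with m hm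
    exact (norm_besselIntegrand_zero s A hm).symm
  · rw [tendsto_zero_iff_norm_tendsto_zero]
    refine (tendsto_rpow_mul_exp_atTop_zero s hA le_rfl).congr' ?_
    filter_upwards [eventually_gt_atTop 0] with m hm
    rw [norm_besselIntegrand_zero s A hm]
    simp

/-- `m ^ r * exp (-m / 2)`, extended by zero to `m ≤ 0`. -/
noncomputable def gammaDensity (r : ℝ) (m : ℝ) : ℂ :=
  (Ioi (0 : ℝ)).indicator (besselIntegrand r (1 / 2) 0) m

theorem integrable_gammaDensity {r : ℝ} (hr : -1 < r) : Integrable (gammaDensity r) := by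
  unfold gammaDensity
  rw [integrable_indicator_iff measurableSet_Ioi]
  exact integrableOn_besselIntegrand_zero hr (by norm_num)

theorem fourier_gammaDensity (r z : ℝ) :
    FourierTransform.fourier (gammaDensity r) z =
      besselIntegral r (1 / 2 + 2 * Real.pi * z * Complex.I) 0 := by
  rw [Real.fourier_real_eq_integral_exp_smul, besselIntegral, ← integral_indicator measurableSet_Ioi]
  congr 1
  ext m
  by_cases hm : m ∈ Ioi (0 : ℝ)
  · simp only [gammaDensity, indicator_of_mem hm, besselIntegrand, smul_eq_mul]
    rw [mul_left_comm, ← Complex.exp_add]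
    congr 2
    push_cast
    ring
  · simp [gammaDensity, indicator_of_notMem hm]

/-- Two integrations by parts give decay like `‖ζ‖⁻²` with `ζ = 1/2 + 2π i z`. The condition `1 < r`
keeps the remaining integrand `m ^ (r - 2)` integrable at zero. -/
theorem integrable_fourier_gammaDensity {r : ℝ} (hr : 1 < r) :
    Integrable (FourierTransform.fourier (gammaDensity r)) := by
  set K := ∫ m in Ioi (0 : ℝ), m ^ (r - 2) * Real.exp (-(1 / 2 * m))
  have hK : 0 ≤ K := setIntegral_nonneg measurableSet_Ioi fun m hm => by
    have hm : 0 < m := hm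
    positivity
  refine (integrable_inv_one_add_sq.const_mul (4 * (r * (r - 1) * K))).mono'
    (VectorFourier.fourierIntegral_continuous Real.continuous_fourierChar
      (by fun_prop) (integrable_gammaDensity (by linarith))).aestronglyMeasurable ?_
  filter_upwards with z
  rw [fourier_gammaDensity]
  set ζ : ℂ := 1 / 2 + 2 * Real.pi * z * Complex.I with hζ
  have hre : ζ.re = 1 / 2 := by simp [hζ]
  have him : ζ.im = 2 * Real.pi * z := by simp [hζ]
  have hpos : 0 < ζ.re := by rw [hre]; norm_num
  have h1 := besselIntegral_zero_recurrence (s := r) (by linarith) hpos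
  have h2 := besselIntegral_zero_recurrence (s := r - 1) (by linarith) hpos
  rw [show r - 1 - 1 = r - 2 by ring] at h2
  have h3 : ζ ^ 2 * besselIntegral r ζ 0 = (r * (r - 1) : ℝ) * besselIntegral (r - 2) ζ 0 := by
    rw [pow_two, mul_assoc, h1, mul_left_comm, h2]
    push_cast
    ring
  have h4 : ‖besselIntegral (r - 2) ζ 0‖ ≤ K := by
    refine norm_integral_le_of_norm_le (integrableOn_rpow_mul_exp_neg (by linarith) (by norm_num)) ?_
    filter_upwards [ae_restrict_mem measurableSet_Ioi] with m hm
    rw [norm_besselIntegrand_zero _ _ hm, hre]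
  have h5 : (1 + z ^ 2) / 4 ≤ ‖ζ ^ 2‖ := by
    rw [norm_pow, ← Complex.normSq_eq_norm_sq, Complex.normSq_apply, hre, him]
    nlinarith [Real.pi_gt_three, sq_nonneg z, mul_nonneg (sq_nonneg z)
      (show (0:ℝ) ≤ Real.pi ^ 2 - 1 by nlinarith [Real.pi_gt_three])]
  have h6 := congrArg norm h3
  rw [norm_mul, norm_mul, Complex.norm_real, Real.norm_of_nonneg
    (mul_nonneg (by linarith) (by linarith))] at h6
  have h7 : (1 + z ^ 2) / 4 * ‖besselIntegral r ζ 0‖ ≤ r * (r - 1) * K := by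
    calc _ ≤ ‖ζ ^ 2‖ * ‖besselIntegral r ζ 0‖ := by gcongr
      _ ≤ _ := by
        rw [h6]
        have : 0 ≤ r * (r - 1) := mul_nonneg (by linarith) (by linarith)
        gcongr
  rw [← div_eq_mul_inv, le_div_iff₀ (by positivity)]
  linarith

theorem besselIntegrand_eq_integral_fourier {r m : ℝ} (hr : 1 < r) (hm : 0 < m) :
    besselIntegrand r (1 / 2) 0 m = ∫ z : ℝ, Complex.exp (((2 * Real.pi * (z * m) : ℝ) : ℂ) *
      Complex.I) * FourierTransform.fourier (gammaDensity r) z := by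
  have hc : ContinuousAt (gammaDensity r) m := by
    have h1 : ContinuousAt (besselIntegrand r (1 / 2) 0) m :=
      (hasDerivAt_besselIntegrand r (1 / 2) 0 hm).continuousAt
    refine h1.congr ?_
    filter_upwards [Ioi_mem_nhds hm] with x hx
    simp [gammaDensity, indicator_of_mem hx]
  have h := (integrable_gammaDensity (by linarith)).fourierInv_fourier_eq
    (integrable_fourier_gammaDensity hr) hc
  rw [gammaDensity, indicator_of_mem (mem_Ioi.2 hm), Real.fourierInv_eq'] at h
  rw [← h]
  congr 1
  ext z
  simp [mul_comm]

/-- Decay of the modified Bessel integral in the second parameter. -/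
theorem exists_norm_besselIntegral_le {s : ℝ} (hs : -1 / 2 < s) : ∃ C : ℝ, 0 ≤ C ∧
    ∀ A B : ℂ, 1 ≤ A.re → 0 < B.re → ‖besselIntegral s A B‖ ≤ C / Real.sqrt ‖B‖ := by
  -- Here `m ^ s = m ^ (-3/2) m ^ r`, and `1 < r` is exactly `-1/2 < s`. The factor `exp (-m / 2)`
  -- that makes `m ^ r` integrable is borrowed from `exp (-A m)`, which is why `A - 1/2` appears and
  -- must have positive real part.
  set r := s + 3 / 2 with hr
  have hr1 : 1 < r := by linarith
  set G := FourierTransform.fourier (gammaDensity r) with hG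
  have hGi : Integrable G := integrable_fourier_gammaDensity hr1
  refine ⟨(∫ z, ‖G z‖) * Real.sqrt Real.pi, by positivity, fun A B hA hB => ?_⟩
  have hA' : 0 < (A - 1 / 2).re := by simp; linarith
  -- Expanding `m ^ r exp (-m / 2)` in characters only shifts `A` by an imaginary amount, to which
  -- the order `-3/2` bound is insensitive.
  let F : ℝ → ℝ → ℂ := fun z m => G z * besselIntegrand (-3 / 2) (A - 1 / 2 - 2 * Real.pi * z * Complex.I) B m
  have hAz : ∀ z : ℝ, (A - 1 / 2 - 2 * Real.pi * z * Complex.I).re = (A - 1 / 2).re := by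
    intro z; simp
  have hF : Integrable (Function.uncurry F) (volume.prod (volume.restrict (Ioi 0))) := by
    have h1 := hGi.norm.mul_prod (integrableOn_rpow_mul_exp (-3 / 2) hA' hB)
    refine h1.mono' ?_ ?_
    · refine AEStronglyMeasurable.mul (hGi.aestronglyMeasurable.comp_fst) ?_
      refine Measurable.aestronglyMeasurable ?_
      unfold besselIntegrand
      fun_prop
    · have : ∀ᵐ q : ℝ × ℝ ∂(volume.prod (volume.restrict (Ioi 0))), q.2 ∈ Ioi (0 : ℝ) :=
        Measure.quasiMeasurePreserving_snd.ae (ae_restrict_mem measurableSet_Ioi)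
      filter_upwards [this] with q hq
      simp only [Function.uncurry, F, norm_mul]
      rw [norm_besselIntegrand _ _ _ hq, hAz]
  have key : besselIntegral s A B =
      ∫ z, G z * besselIntegral (-3 / 2) (A - 1 / 2 - 2 * Real.pi * z * Complex.I) B := by
    have h2 : ∀ z, G z * besselIntegral (-3 / 2) (A - 1 / 2 - 2 * Real.pi * z * Complex.I) B =
        ∫ m in Ioi (0 : ℝ), F z m := fun z => by
      rw [besselIntegral, ← integral_const_mul]
    simp_rw [h2]
    rw [integral_integral_swap hF, besselIntegral]
    refine setIntegral_congr_fun measurableSet_Ioi fun m hm => ?_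
    have hm : 0 < m := hm
    have h3 : besselIntegrand s A B m =
        besselIntegrand (-3 / 2) (A - 1 / 2) B m * besselIntegrand r (1 / 2) 0 m := by
      simp only [besselIntegrand]
      rw [show s = -3 / 2 + r by rw [hr]; ring, Real.rpow_add hm, Complex.ofReal_mul,
        mul_mul_mul_comm, ← Complex.exp_add]
      congr 2
      ring
    rw [h3, besselIntegrand_eq_integral_fourier hr1 hm, ← integral_const_mul]
    congr 1
    ext z
    simp only [F, besselIntegrand]
    rw [← hG, mul_left_comm (G z), ← mul_assoc, mul_assoc _ (Complex.exp _) (Complex.exp _),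
      ← Complex.exp_add, mul_comm (G z), mul_assoc]
    congr 3
    push_cast
    ring
  rw [key, mul_div_assoc, ← integral_mul_const]
  refine norm_integral_le_of_norm_le (hGi.norm.mul_const _) ?_
  filter_upwards with z
  rw [norm_mul]
  gcongr
  exact norm_besselIntegral_neg_three_half_le (by rw [hAz]; exact hA') hB

/-! ### The Fourier transform of `exp (-2 α √(μ² + ν² ‖η‖²))` by subordination to Gaussians. -/

section

theorem cpow_half_eq_of_mul_self {z u : ℂ} (hz : 0 < z.re) (h : u * u = z) (hu : 0 < u.re) :
    z ^ (1 / 2 : ℂ) = u := by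
  have h1 := cpow_half_mul_self z
  have h2 := re_cpow_half_pos hz
  have h3 : (z ^ (1 / 2 : ℂ) - u) * (z ^ (1 / 2 : ℂ) + u) = 0 := by linear_combination h1 - h
  rcases mul_eq_zero.1 h3 with h4 | h4
  · exact sub_eq_zero.1 h4
  · have := congrArg Complex.re h4
    simp only [Complex.add_re, Complex.zero_re] at this
    linarith

/-- Subordination of the exponential to Gaussians. -/
theorem besselIntegral_neg_half_mul_sq {α : ℂ} (hα : 0 < α.re) {w : ℝ} (hw : 0 < w) :
    besselIntegral (-1 / 2) α (α * (w : ℂ) ^ 2) =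
      (Real.pi / α) ^ (1 / 2 : ℂ) * Complex.exp (-2 * α * w) := by
  have hσ := re_cpow_half_pos hα
  have hB : 0 < (α * (w : ℂ) ^ 2).re := by
    rw [← Complex.ofReal_pow, Complex.re_mul_ofReal]; positivity
  have h1 := cpow_half_mul_self α
  rw [besselIntegral_neg_half hα hB, cpow_half_eq_of_mul_self hB (u := α ^ (1 / 2 : ℂ) * w)]
  · congr 2
    linear_combination (-2 * (w : ℂ)) * h1
  · linear_combination ((w : ℂ) ^ 2) * h1
  · rw [Complex.re_mul_ofReal]; positivity

variable {V : Type*} [NormedAddCommGroup V] [InnerProductSpace ℝ V] [FiniteDimensional ℝ V]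
  [MeasurableSpace V] [BorelSpace V]

theorem mul_ofReal_cpow {c : ℂ} (hc : c ≠ 0) {m : ℝ} (hm : 0 < m) (r : ℝ) :
    (c * m) ^ (r : ℂ) = c ^ (r : ℂ) * ((m ^ r : ℝ) : ℂ) := by
  have hmc : (m : ℂ) ≠ 0 := by exact_mod_cast hm.ne'
  rw [Complex.ofReal_cpow hm.le, Complex.cpow_def_of_ne_zero (mul_ne_zero hc hmc),
    Complex.log_mul_ofReal _ hm _ hc, Complex.cpow_def_of_ne_zero hc,
    Complex.cpow_def_of_ne_zero hmc, ← Complex.exp_add, Complex.ofReal_log hm.le]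
  ring_nf

/-- The Fourier transform of `exp (-2 α √(μ² + ν² ‖η‖²))`. -/
noncomputable def expSqrtTransform (α : ℂ) (μ ν : ℝ) (z : V) : ℂ :=
  ∫ η : V, Complex.exp (Complex.I * (inner ℝ z η : ℝ)) *
    Complex.exp (-2 * α * (Real.sqrt (μ ^ 2 + ν ^ 2 * ‖η‖ ^ 2) : ℝ))

/-- The exponential is replaced by its Bessel integral over `m`, and the order of integration is
exchanged. The inner integral over `η` is Gaussian with parameter `α ν² / m`: it contributes `m ^ (n
/ 2)`, which raises the order from `-1/2` to `(n - 1) / 2`, and a factor `exp (-‖z‖² m / (4 α ν²))`,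
which changes `A`. -/
theorem expSqrtTransform_eq {α : ℂ} (hα : 0 < α.re) {μ ν : ℝ} (hμ : 0 < μ) (hν : 0 < ν) (z : V) :
    (Real.pi / α) ^ (1 / 2 : ℂ) * expSqrtTransform α μ ν z =
      (Real.pi / (α * (ν : ℂ) ^ 2)) ^ (((Module.finrank ℝ V / 2 : ℝ)) : ℂ) *
      besselIntegral (((Module.finrank ℝ V : ℝ) - 1) / 2)
        (α + (‖z‖ : ℂ) ^ 2 / (4 * (α * (ν : ℂ) ^ 2))) (α * (μ : ℂ) ^ 2) := by
  have hα0 : α ≠ 0 := by rintro rfl; simp at hα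
  have hνc : (ν : ℂ) ≠ 0 := by exact_mod_cast hν.ne'
  set n := Module.finrank ℝ V
  let F : V → ℝ → ℂ := fun η m => Complex.exp (Complex.I * (inner ℝ z η : ℝ)) *
    besselIntegrand (-1 / 2) α (α * ((Real.sqrt (μ ^ 2 + ν ^ 2 * ‖η‖ ^ 2) : ℝ) : ℂ) ^ 2) m
  have hsq : ∀ η : V, Real.sqrt (μ ^ 2 + ν ^ 2 * ‖η‖ ^ 2) ^ 2 = μ ^ 2 + ν ^ 2 * ‖η‖ ^ 2 :=
    fun η => Real.sq_sqrt (by positivity)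
  have hgauss : ∀ (b : ℝ), 0 < b → Integrable (fun η : V => Real.exp (-(b * ‖η‖ ^ 2))) := by
    intro b hb
    have := (GaussianFourier.integrable_cexp_neg_mul_sq_norm_add (b := (b : ℂ)) (by simpa) 0 (0 : V)).norm
    refine this.congr ?_
    filter_upwards with η
    rw [Complex.norm_exp]
    simp [← Complex.ofReal_pow]
  have hnormF : ∀ η : V, ∀ m : ℝ, 0 < m → ‖F η m‖ = m ^ (-1 / 2 : ℝ) *
      Real.exp (-(α.re * m) - α.re * μ ^ 2 / m) * Real.exp (-((α.re * ν ^ 2 / m) * ‖η‖ ^ 2)) := by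
    intro η m hm
    simp only [F, norm_mul]
    rw [norm_besselIntegrand _ _ _ hm, ← Complex.ofReal_pow, hsq, Complex.re_mul_ofReal,
      mul_comm Complex.I, Complex.norm_exp_ofReal_mul_I, one_mul, mul_assoc, ← Real.exp_add]
    congr 2
    field_simp
    ring
  have hmeas : AEStronglyMeasurable (Function.uncurry F)
      ((volume : Measure V).prod (volume.restrict (Ioi (0 : ℝ)))) := by
    refine Measurable.aestronglyMeasurable ?_
    have h0 : Measurable fun q : V × ℝ => q.1 := measurable_fst
    have h1 : Measurable fun q : V × ℝ => (inner ℝ z q.1 : ℝ) := by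
      have : Continuous fun η : V => (inner ℝ z η : ℝ) := by fun_prop
      exact this.measurable.comp measurable_fst
    unfold Function.uncurry
    simp only [F, besselIntegrand]
    fun_prop
  have hF : Integrable (Function.uncurry F)
      ((volume : Measure V).prod (volume.restrict (Ioi (0 : ℝ)))) := by
    rw [integrable_prod_iff' hmeas]
    refine ⟨?_, ?_⟩
    · filter_upwards [ae_restrict_mem measurableSet_Ioi] with m hm
      have hm : 0 < m := hm
      have hs : Measurable fun η : V => Function.uncurry F (η, m) := by
        unfold Function.uncurry
        simp only [F, besselIntegrand]
        have : Continuous fun η : V => (inner ℝ z η : ℝ) := by fun_prop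
        have := this.measurable
        fun_prop
      refine Integrable.mono' ((hgauss (α.re * ν ^ 2 / m) (by positivity)).const_mul
        (m ^ (-1 / 2 : ℝ) * Real.exp (-(α.re * m) - α.re * μ ^ 2 / m))) hs.aestronglyMeasurable ?_
      filter_upwards with η
      exact (hnormF η m hm).le
    · have h1 : IntegrableOn (fun m : ℝ => (Real.pi / (α.re * ν ^ 2)) ^ (n / 2 : ℝ) *
          (m ^ (((n : ℝ) - 1) / 2) * Real.exp (-(α.re * m) - α.re * μ ^ 2 / m))) (Ioi 0) :=
        (integrableOn_rpow_mul_exp _ hα (by positivity)).const_mul _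
      refine h1.congr ?_
      filter_upwards [ae_restrict_mem measurableSet_Ioi] with m hm
      have hm : 0 < m := hm
      simp only [Function.uncurry]
      simp_rw [hnormF _ m hm]
      rw [integral_const_mul]
      have h2 := GaussianFourier.integral_rexp_neg_mul_sq_norm (V := V)
        (b := α.re * ν ^ 2 / m) (by positivity)
      simp_rw [neg_mul] at h2
      rw [h2, show Real.pi / (α.re * ν ^ 2 / m) = Real.pi / (α.re * ν ^ 2) * m by field_simp,
        Real.mul_rpow (by positivity) hm.le,
        show ((n : ℝ) - 1) / 2 = n / 2 + -1 / 2 by ring, Real.rpow_add hm]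
      ring
  have h1 : (Real.pi / α) ^ (1 / 2 : ℂ) * expSqrtTransform α μ ν z =
      ∫ η : V, ∫ m in Ioi (0 : ℝ), F η m := by
    rw [expSqrtTransform, ← integral_const_mul]
    congr 1
    ext η
    simp only [F]
    rw [integral_const_mul, ← besselIntegral, besselIntegral_neg_half_mul_sq hα (by positivity)]
    ring
  rw [h1, integral_integral_swap hF, besselIntegral, ← integral_const_mul]
  refine setIntegral_congr_fun measurableSet_Ioi fun m hm => ?_
  have hm : 0 < m := hm
  have hmc : (m : ℂ) ≠ 0 := by exact_mod_cast hm.ne'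
  set b : ℂ := α * (ν : ℂ) ^ 2 / m with hb
  have hbre : 0 < b.re := by
    rw [hb, ← Complex.ofReal_pow, Complex.div_ofReal_re, Complex.re_mul_ofReal]; positivity
  have h2 : ∀ η : V, F η m = besselIntegrand (-1 / 2) α (α * (μ : ℂ) ^ 2) m *
      Complex.exp (-b * ‖η‖ ^ 2 + Complex.I * (inner ℝ z η : ℝ)) := by
    intro η
    simp only [F, besselIntegrand]
    rw [← Complex.ofReal_pow, hsq, mul_left_comm, mul_assoc, ← Complex.exp_add, ← Complex.exp_add]
    congr 2
    rw [hb]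
    push_cast
    field_simp
    ring
  simp_rw [h2]
  rw [integral_const_mul, GaussianFourier.integral_cexp_neg_mul_sq_norm_add hbre]
  have h3 : (Real.pi / b : ℂ) = Real.pi / (α * (ν : ℂ) ^ 2) * m := by
    rw [hb]; field_simp
  have h4 : ((n : ℂ) / 2) = ((n / 2 : ℝ) : ℂ) := by push_cast; rfl
  have h5 : (Real.pi / (α * (ν : ℂ) ^ 2)) ≠ 0 :=
    div_ne_zero (by exact_mod_cast Real.pi_ne_zero) (mul_ne_zero hα0 (pow_ne_zero _ hνc))
  change _ * (((Real.pi : ℂ) / b) ^ ((n : ℂ) / 2) * _) = _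
  rw [h3, h4, mul_ofReal_cpow h5 hm]
  simp only [besselIntegrand]
  rw [show ((n : ℝ) - 1) / 2 = n / 2 + -1 / 2 by ring, Real.rpow_add hm, Complex.ofReal_mul]
  have h6 : Complex.exp (-((α + (‖z‖ : ℂ) ^ 2 / (4 * (α * (ν : ℂ) ^ 2))) * m) - α * (μ : ℂ) ^ 2 / m) =
      Complex.exp (-(α * m) - α * (μ : ℂ) ^ 2 / m) *
      Complex.exp (Complex.I ^ 2 * (‖z‖ : ℂ) ^ 2 / (4 * b)) := by
    rw [← Complex.exp_add, Complex.I_sq, hb]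
    congr 1
    field_simp
    ring
  rw [h6]
  ring

end

section

variable {V : Type*} [NormedAddCommGroup V] [InnerProductSpace ℝ V] [FiniteDimensional ℝ V]
  [MeasurableSpace V] [BorelSpace V]

theorem norm_expSqrtTransform {α : ℂ} (hα : 0 < α.re) {μ ν : ℝ} (hμ : 0 < μ) (hν : 0 < ν) (z : V) :
    ‖expSqrtTransform α μ ν z‖ = Real.pi ^ (((Module.finrank ℝ V : ℝ) - 1) / 2) *
      ((ν ^ Module.finrank ℝ V)⁻¹ * ‖α‖ ^ ((1 - (Module.finrank ℝ V : ℝ)) / 2)) *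
      ‖besselIntegral (((Module.finrank ℝ V : ℝ) - 1) / 2)
        (α + (‖z‖ : ℂ) ^ 2 / (4 * (α * (ν : ℂ) ^ 2))) (α * (μ : ℂ) ^ 2)‖ := by
  have hα0 : 0 < ‖α‖ := norm_pos_iff.2 (by rintro rfl; simp at hα)
  have h := congrArg norm (expSqrtTransform_eq hα hμ hν z)
  set n := Module.finrank ℝ V
  set b := besselIntegral (((n : ℝ) - 1) / 2)
        (α + (‖z‖ : ℂ) ^ 2 / (4 * (α * (ν : ℂ) ^ 2))) (α * (μ : ℂ) ^ 2)
  rw [norm_mul, norm_mul, show (1 / 2 : ℂ) = ((1 / 2 : ℝ) : ℂ) by push_cast; rfl,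
    Complex.norm_cpow_real, Complex.norm_cpow_real, norm_div, norm_div, norm_mul, norm_pow,
    Complex.norm_real, Complex.norm_real, Real.norm_of_nonneg Real.pi_pos.le,
    Real.norm_of_nonneg hν.le] at h
  have h1 : (ν ^ 2) ^ ((n : ℝ) / 2) = ν ^ n := by
    rw [← Real.rpow_natCast, ← Real.rpow_mul hν.le, ← Real.rpow_natCast]
    congr 1
    push_cast
    ring
  rw [Real.div_rpow Real.pi_pos.le (by positivity), Real.div_rpow Real.pi_pos.le (by positivity),
    Real.mul_rpow (by positivity) (by positivity), h1] at h
  have h2 : Real.pi ^ (((n : ℝ) - 1) / 2) = Real.pi ^ ((n : ℝ) / 2) / Real.pi ^ (1 / 2 : ℝ) := by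
    rw [← Real.rpow_sub Real.pi_pos]; ring_nf
  have h3 : ‖α‖ ^ ((1 - (n : ℝ)) / 2) = ‖α‖ ^ (1 / 2 : ℝ) / ‖α‖ ^ ((n : ℝ) / 2) := by
    rw [← Real.rpow_sub hα0]; ring_nf
  have hp : 0 < Real.pi ^ (1 / 2 : ℝ) := by positivity
  have ha : 0 < ‖α‖ ^ (1 / 2 : ℝ) := by positivity
  rw [h2, h3]
  field_simp at h ⊢
  linarith

/-- Uniform bounds for the Fourier transform of `exp (-2 α √(μ² + ν² ‖η‖²))`. -/
theorem exists_norm_expSqrtTransform_le (hV : 1 ≤ Module.finrank ℝ V) : ∃ C : ℝ, 0 ≤ C ∧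
    ∀ (α : ℂ) (μ ν : ℝ) (z : V), 1 ≤ α.re → 0 < μ → 0 < ν →
      ‖expSqrtTransform α μ ν z‖ ≤
        C * ((ν ^ Module.finrank ℝ V)⁻¹ * ‖α‖ ^ ((1 - (Module.finrank ℝ V : ℝ)) / 2)) ∧
      ‖expSqrtTransform α μ ν z‖ ≤
        C * ((ν ^ Module.finrank ℝ V)⁻¹ * (‖α‖ ^ (-(Module.finrank ℝ V : ℝ) / 2) * μ⁻¹)) := by
  set n := Module.finrank ℝ V
  have hn : (1 : ℝ) ≤ n := by exact_mod_cast hV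
  obtain ⟨C, hC, hbound⟩ := exists_norm_besselIntegral_le (s := ((n : ℝ) - 1) / 2) (by linarith)
  set K := ∫ m in Ioi (0 : ℝ), m ^ (((n : ℝ) - 1) / 2) * Real.exp (-(1 * m))
  have hK : 0 ≤ K := setIntegral_nonneg measurableSet_Ioi fun m hm => by
    have hm : 0 < m := hm
    positivity
  set p := Real.pi ^ (((n : ℝ) - 1) / 2)
  have hp : 0 < p := by positivity
  refine ⟨p * (K + C), by positivity, fun α μ ν z hα hμ hν => ?_⟩
  have hα' : 0 < α.re := by linarith
  have hα0 : 0 < ‖α‖ := norm_pos_iff.2 (by rintro rfl; simp at hα')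
  set A := α + (‖z‖ : ℂ) ^ 2 / (4 * (α * (ν : ℂ) ^ 2)) with hA
  -- The term added to `α` is a nonnegative multiple of `α⁻¹`, whose real part is positive; hence
  -- the bounds are uniform in `z`.
  have hAre : 1 ≤ A.re := by
    have h1 : (‖z‖ : ℂ) ^ 2 / (4 * (α * (ν : ℂ) ^ 2)) =
        ((‖z‖ ^ 2 / (4 * ν ^ 2) : ℝ) : ℂ) * α⁻¹ := by
      push_cast
      rw [div_eq_mul_inv, div_eq_mul_inv, mul_inv, mul_inv, mul_inv]
      ring
    rw [hA, h1, Complex.add_re, Complex.re_ofReal_mul, Complex.inv_re]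
    have : 0 ≤ ‖z‖ ^ 2 / (4 * ν ^ 2) * (α.re / Complex.normSq α) :=
      mul_nonneg (by positivity) (div_nonneg hα'.le (Complex.normSq_nonneg _))
    linarith
  have hBre : 0 < (α * (μ : ℂ) ^ 2).re := by
    rw [← Complex.ofReal_pow, Complex.re_mul_ofReal]; positivity
  have hb1 : ‖besselIntegral (((n : ℝ) - 1) / 2) A (α * (μ : ℂ) ^ 2)‖ ≤ K := by
    refine norm_integral_le_of_norm_le (integrableOn_rpow_mul_exp_neg (by linarith) one_pos) ?_
    filter_upwards [ae_restrict_mem measurableSet_Ioi] with m hm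
    have hm : 0 < m := hm
    rw [norm_besselIntegrand _ _ _ hm]
    gcongr
    have : 0 < (α * (μ : ℂ) ^ 2).re / m := by positivity
    nlinarith
  have hb2 : ‖besselIntegral (((n : ℝ) - 1) / 2) A (α * (μ : ℂ) ^ 2)‖ ≤
      C * (‖α‖ ^ (-1 / 2 : ℝ) * μ⁻¹) := by
    refine (hbound A _ hAre hBre).trans (le_of_eq ?_)
    rw [norm_mul, norm_pow, Complex.norm_real, Real.norm_of_nonneg hμ.le,
      Real.sqrt_mul (norm_nonneg _), Real.sqrt_sq hμ.le, Real.sqrt_eq_rpow, div_eq_mul_inv,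
      mul_inv, ← Real.rpow_neg hα0.le]
    norm_num
  rw [norm_expSqrtTransform hα' hμ hν z]
  set q := (ν ^ n)⁻¹ * ‖α‖ ^ ((1 - (n : ℝ)) / 2) with hq
  have hq0 : 0 < q := by positivity
  constructor
  · calc _ ≤ p * q * K := by gcongr
      _ ≤ p * (K + C) * q := by nlinarith [mul_nonneg (mul_nonneg hp.le hq0.le) hC]
  · have h4 : ‖α‖ ^ (-(n : ℝ) / 2) = ‖α‖ ^ ((1 - (n : ℝ)) / 2) * ‖α‖ ^ (-1 / 2 : ℝ) := by
      rw [← Real.rpow_add hα0]; ring_nf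
    have h5 : (ν ^ n)⁻¹ * (‖α‖ ^ (-(n : ℝ) / 2) * μ⁻¹) = q * (‖α‖ ^ (-1 / 2 : ℝ) * μ⁻¹) := by
      rw [h4, hq]; ring
    rw [h5]
    have hr : 0 < ‖α‖ ^ (-1 / 2 : ℝ) * μ⁻¹ := by positivity
    calc _ ≤ p * q * (C * (‖α‖ ^ (-1 / 2 : ℝ) * μ⁻¹)) := by gcongr
      _ ≤ _ := by
        nlinarith [mul_nonneg (mul_nonneg (mul_nonneg hp.le hq0.le) hr.le) hK]

/-- The integrand defining `expSqrtTransform` is integrable. -/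
theorem integrable_exp_neg_sqrt (a : ℝ) (ha : 0 < a) (μ : ℝ) {ν : ℝ} (hν : 0 < ν) :
    Integrable (fun η : V => Real.exp (-(a * Real.sqrt (μ ^ 2 + ν ^ 2 * ‖η‖ ^ 2)))) := by
  have h1 : Integrable (fun η : V => Real.exp (-(a * ν) * ‖η‖)) := by
    set c := a * ν
    have hc : 0 < c := by positivity
    set k := Module.finrank ℝ V + 1
    have h2 : Integrable (fun η : V => Real.exp c * (k.factorial / c ^ k) *
        (1 + ‖η‖) ^ (-(k : ℝ))) :=
      (integrable_one_add_norm (by simp [k])).const_mul _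
    refine h2.mono' (by fun_prop) ?_
    filter_upwards with η
    rw [Real.norm_of_nonneg (Real.exp_pos _).le, Real.rpow_neg (by positivity), Real.rpow_natCast]
    have h3 := Real.pow_div_factorial_le_exp (c * (1 + ‖η‖)) (by positivity) k
    have h4 : Real.exp (-(c * (1 + ‖η‖))) ≤ k.factorial / c ^ k * ((1 + ‖η‖) ^ k)⁻¹ := by
      rw [Real.exp_neg]
      refine (inv_anti₀ (by positivity) h3).trans (le_of_eq ?_)
      rw [mul_pow]
      field_simp
    calc Real.exp (-c * ‖η‖) = Real.exp c * Real.exp (-(c * (1 + ‖η‖))) := by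
          rw [← Real.exp_add]; ring_nf
      _ ≤ Real.exp c * (k.factorial / c ^ k * ((1 + ‖η‖) ^ k)⁻¹) := by gcongr
      _ = _ := by ring
  refine h1.mono' (by fun_prop) ?_
  filter_upwards with η
  rw [Real.norm_of_nonneg (Real.exp_pos _).le]
  gcongr
  rw [neg_mul, neg_le_neg_iff, mul_assoc]
  gcongr
  apply Real.le_sqrt_of_sq_le
  nlinarith [sq_nonneg μ]

end

/-! ### Oscillatory integrals reduced to the transform of the exponential. -/

section

/-- A smooth function on `ℝ` which is `exp (2 √s)` for `s ≥ 1 / 4` and vanishes near `s ≤ 0`. -/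
noncomputable def smoothExpSqrt (s : ℝ) : ℝ :=
  Real.smoothTransition (8 * s - 1) * Real.exp (2 * Real.sqrt s)

theorem smoothExpSqrt_of_le {s : ℝ} (hs : 1 / 4 ≤ s) :
    smoothExpSqrt s = Real.exp (2 * Real.sqrt s) := by
  rw [smoothExpSqrt, Real.smoothTransition.one_of_one_le (by linarith), one_mul]

theorem contDiff_smoothExpSqrt : ContDiff ℝ ∞ smoothExpSqrt := by
  rw [contDiff_iff_contDiffAt]
  intro s
  rcases lt_or_ge 0 s with hs | hs
  · refine ContDiffAt.mul ?_ ?_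
    · exact (Real.smoothTransition.contDiff.comp (by fun_prop)).contDiffAt
    · exact (contDiffAt_const.mul (Real.contDiffAt_sqrt hs.ne')).exp
  · have : smoothExpSqrt =ᶠ[𝓝 s] fun _ => 0 := by
      filter_upwards [Iio_mem_nhds (show s < 1 / 8 by linarith)] with x hx
      have hx : x < 1 / 8 := hx
      rw [smoothExpSqrt, Real.smoothTransition.zero_of_nonpos (by linarith), zero_mul]
    exact contDiffAt_const.congr_of_eventuallyEq this

variable {V : Type*} [NormedAddCommGroup V] [InnerProductSpace ℝ V] [FiniteDimensional ℝ V]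
  [MeasurableSpace V] [BorelSpace V]

-- Treating `μ` as an extra variable, with `ν² = 1 - μ²`, yields a single Schwartz function for all
-- parameters, which is the source of uniformity. The lower bound `1 / 4` keeps the argument of the
-- root away from its singularity at zero.
omit [FiniteDimensional ℝ V] [MeasurableSpace V] [BorelSpace V] in
theorem exists_schwartz_amplitude (a : V → ℝ) (ha : ContDiff ℝ ∞ a) (hc : HasCompactSupport a) :
    ∃ G : 𝓢(WithLp 2 (ℝ × V), ℂ), ∀ μ η, |μ| ≤ 1 → (a η ≠ 0 → 1 / 4 ≤ μ ^ 2 + (1 - μ ^ 2) * ‖η‖ ^ 2) →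
      G (WithLp.toLp 2 (μ, η)) =
        a η * Real.exp (2 * Real.sqrt (μ ^ 2 + (1 - μ ^ 2) * ‖η‖ ^ 2)) := by
  let κ : ContDiffBump (0 : ℝ) := ⟨1, 2, one_pos, one_lt_two⟩
  let g : ℝ × V → ℝ := fun q => κ q.1 * (a q.2 * smoothExpSqrt (q.1 ^ 2 + (1 - q.1 ^ 2) * ‖q.2‖ ^ 2))
  have hg : ContDiff ℝ ∞ g := by
    refine (κ.contDiff.comp contDiff_fst).mul ((ha.comp contDiff_snd).mul
      (contDiff_smoothExpSqrt.comp ?_))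
    have : ContDiff ℝ ∞ fun q : ℝ × V => ‖q.2‖ ^ 2 := contDiff_snd.norm_sq ℝ
    fun_prop
  have hgc : HasCompactSupport g := by
    refine HasCompactSupport.intro (κ.hasCompactSupport.isCompact.prod hc.isCompact) ?_
    intro q hq
    rw [mem_prod, not_and_or] at hq
    rcases hq with hq | hq
    · simp [g, image_eq_zero_of_notMem_tsupport hq]
    · simp [g, image_eq_zero_of_notMem_tsupport hq]
  let L := WithLp.prodContinuousLinearEquiv 2 ℝ ℝ V
  have h1 : ContDiff ℝ ∞ fun w : WithLp 2 (ℝ × V) => ((g (L w) : ℝ) : ℂ) :=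
    Complex.ofRealCLM.contDiff.comp (hg.comp L.contDiff)
  have h2 : HasCompactSupport fun w : WithLp 2 (ℝ × V) => ((g (L w) : ℝ) : ℂ) :=
    (hgc.comp_homeomorph L.toHomeomorph).comp_left (g := Complex.ofReal) rfl
  refine ⟨h2.toSchwartzMap h1, fun μ η hμ hη => ?_⟩
  change ((g (μ, η) : ℝ) : ℂ) = _
  have hk : κ μ = 1 := κ.one_of_mem_closedBall (by simpa using hμ)
  simp only [g, hk, one_mul]
  by_cases h0 : a η = 0
  · simp [h0]
  · rw [smoothExpSqrt_of_le (hη h0)]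
    push_cast
    rfl

/-- An oscillatory integral with phase `√(μ² + ν² ‖η‖²)` and a fixed amplitude is controlled by the
transform of the exponential, uniformly in the parameters. -/
theorem exists_norm_oscillatory_le (a : V → ℝ) (ha : ContDiff ℝ ∞ a) (hc : HasCompactSupport a) :
    ∃ C : ℝ, 0 ≤ C ∧ ∀ (μ ν τ : ℝ) (x : V), 0 < μ → 0 < ν → μ ^ 2 + ν ^ 2 = 1 →
      (∀ η, a η ≠ 0 → 1 / 4 ≤ μ ^ 2 + ν ^ 2 * ‖η‖ ^ 2) →
      ∀ M : ℝ, (∀ z : V, ‖expSqrtTransform (1 - τ / 2 * Complex.I) μ ν z‖ ≤ M) →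
      ‖∫ η : V, Complex.exp (Complex.I * (inner ℝ x η : ℝ)) * (a η *
        Complex.exp (Complex.I * ((τ * Real.sqrt (μ ^ 2 + ν ^ 2 * ‖η‖ ^ 2) : ℝ) : ℂ)))‖ ≤ C * M := by
  obtain ⟨G, hG⟩ := exists_schwartz_amplitude a ha hc
  set H : 𝓢(WithLp 2 (ℝ × V), ℂ) := FourierTransform.fourier G with hH
  have hHi : Integrable (H : WithLp 2 (ℝ × V) → ℂ) := H.integrable
  refine ⟨∫ w, ‖H w‖, by positivity, fun μ ν τ x hμ hν hμν hη M hM => ?_⟩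
  -- Chosen so that `exp (i τ S) = exp (2 S) exp (-2 α S)`: real part `1` provides decay in `η`, and
  -- the growing factor is harmless on the support of `a`.
  set α : ℂ := 1 - τ / 2 * Complex.I with hα
  have hαre : α.re = 1 := by simp [hα]
  have hν2 : ν ^ 2 = 1 - μ ^ 2 := by linarith
  have hμ1 : |μ| ≤ 1 := by
    rw [abs_le]; constructor <;> nlinarith
  set S : V → ℝ := fun η => Real.sqrt (μ ^ 2 + ν ^ 2 * ‖η‖ ^ 2) with hS
  have hrep : ∀ η : V, (a η * Real.exp (2 * S η) : ℂ) =
      ∫ w : WithLp 2 (ℝ × V), Complex.exp (((2 * Real.pi * (w.ofLp.1 * μ + inner ℝ w.ofLp.2 η) : ℝ) : ℂ)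
        * Complex.I) * H w := by
    intro η
    have h1 := hG μ η hμ1 (fun h => by have := hη η h; rwa [hν2] at this)
    rw [← hν2] at h1
    rw [← h1]
    have h2 : G = FourierTransformInv.fourierInv H := by
      rw [hH, FourierTransform.fourierInv_fourier_eq]
    conv_lhs => rw [h2]
    rw [SchwartzMap.fourierInv_coe, Real.fourierInv_eq']
    congr 1
    ext w
    rw [smul_eq_mul, WithLp.prod_inner_apply]
    simp [mul_comm]
  let F : V → WithLp 2 (ℝ × V) → ℂ := fun η w =>
    Complex.exp (Complex.I * (inner ℝ x η : ℝ)) *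
      (Complex.exp (((2 * Real.pi * (w.ofLp.1 * μ + inner ℝ w.ofLp.2 η) : ℝ) : ℂ) * Complex.I) * H w) *
      Complex.exp (-2 * α * (S η : ℝ))
  have hF : Integrable (Function.uncurry F) ((volume : Measure V).prod volume) := by
    have h1 := (integrable_exp_neg_sqrt (V := V) 2 two_pos μ hν).mul_prod hHi.norm
    refine h1.mono' ?_ ?_
    · have hc1 : Continuous (Function.uncurry F) := by
        have := H.continuous
        unfold Function.uncurry
        simp only [F, hS]
        fun_prop
      exact hc1.aestronglyMeasurable
    · filter_upwards with q
      simp only [Function.uncurry, F, norm_mul]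
      rw [mul_comm Complex.I, Complex.norm_exp_ofReal_mul_I, Complex.norm_exp_ofReal_mul_I,
        Complex.norm_exp, one_mul, one_mul, mul_comm]
      simp [hαre, hS]
  have key : ∫ η : V, Complex.exp (Complex.I * (inner ℝ x η : ℝ)) * (a η *
        Complex.exp (Complex.I * ((τ * S η : ℝ) : ℂ))) =
      ∫ w : WithLp 2 (ℝ × V), Complex.exp (((2 * Real.pi * (w.ofLp.1 * μ) : ℝ) : ℂ) * Complex.I) *
        H w * expSqrtTransform α μ ν (x + (2 * Real.pi) • w.ofLp.2) := by
    calc _ = ∫ η : V, ∫ w : WithLp 2 (ℝ × V), F η w := by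
          congr 1
          ext η
          simp only [F]
          rw [integral_mul_const, integral_const_mul, ← hrep η]
          have : Complex.exp (Complex.I * ((τ * S η : ℝ) : ℂ)) =
              Real.exp (2 * S η) * Complex.exp (-2 * α * (S η : ℝ)) := by
            rw [Complex.ofReal_exp, ← Complex.exp_add, hα]
            congr 1
            push_cast
            ring
          rw [this]
          ring
      _ = ∫ w : WithLp 2 (ℝ × V), ∫ η : V, F η w := integral_integral_swap hF
      _ = _ := by
          congr 1
          ext w
          rw [expSqrtTransform, ← integral_const_mul]
          congr 1
          ext η
          simp only [F, hS]
          rw [inner_add_left, inner_smul_left]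
          have : Complex.exp (Complex.I * ((inner ℝ x η + (starRingEnd ℝ) (2 * Real.pi) *
                inner ℝ w.ofLp.2 η : ℝ) : ℂ)) * Complex.exp (((2 * Real.pi * (w.ofLp.1 * μ) : ℝ) : ℂ)
                * Complex.I) = Complex.exp (Complex.I * (inner ℝ x η : ℝ)) *
              Complex.exp (((2 * Real.pi * (w.ofLp.1 * μ + inner ℝ w.ofLp.2 η) : ℝ) : ℂ) * Complex.I) := by
            rw [← Complex.exp_add, ← Complex.exp_add]
            congr 1
            push_cast
            simp
            ring
          linear_combination (-(H w * Complex.exp (-2 * α *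
            (Real.sqrt (μ ^ 2 + ν ^ 2 * ‖η‖ ^ 2) : ℝ)))) * this
  -- By `key` the integral is an average of translates of the transform, weighted by `H` and
  -- unimodular factors, so `C` is the `L¹` norm of `H`.
  rw [key, ← integral_mul_const]
  refine norm_integral_le_of_norm_le (hHi.norm.mul_const M) ?_
  filter_upwards with w
  rw [norm_mul, norm_mul, Complex.norm_exp_ofReal_mul_I, one_mul]
  gcongr
  exact hM _

end

/-! ### The pointwise kernel bound for `Δ_j U_λ(t)`. -/

section

theorem le_rpow_mul_rpow {k X Y θ : ℝ} (hk : 0 ≤ k) (hX : k ≤ X) (hY : k ≤ Y) (h0 : 0 ≤ θ)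
    (h1 : θ ≤ 1) : k ≤ X ^ (1 - θ) * Y ^ θ := by
  rcases hk.eq_or_lt with rfl | hk
  · exact mul_nonneg (Real.rpow_nonneg hX _) (Real.rpow_nonneg hY _)
  calc k = k ^ (1 - θ) * k ^ θ := by rw [← Real.rpow_add hk]; simp
    _ ≤ _ := by
      have hX0 : 0 < X := hk.trans_le hX
      gcongr

/-- Interpolation between the three basic kernel bounds. -/
theorem dispersive_interpolation {d : ℕ} (hd : 1 ≤ d) {C k N lam T L θ : ℝ} (hC : 0 < C)
    (hk : 0 ≤ k) (hN : 0 < N) (hl : 0 < lam) (hT : 0 < T) (hL : L = Real.sqrt (lam ^ 2 + N ^ 2))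
    (h0 : 0 ≤ θ) (h1 : θ ≤ 1) (b0 : k ≤ C * N ^ (d : ℝ))
    (b1 : k ≤ C * (L ^ (d : ℝ) * (T * L) ^ ((1 - (d : ℝ)) / 2)))
    (b2 : k ≤ C * (L ^ (d : ℝ) * ((T * L) ^ (-(d : ℝ) / 2) * (L / lam)))) :
    k ≤ C * 2 ^ ((d : ℝ) + 1) * T ^ (-(((d : ℝ) - 1 + θ) / 2)) *
      (lam ^ (((d : ℝ) - 1 + θ) / 2) * N ^ (1 - θ) +
        lam ^ (-θ) * N ^ (((d : ℝ) + 1 + θ) / 2)) := by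
  have hd' : (1 : ℝ) ≤ d := by exact_mod_cast hd
  have hL0 : 0 < L := by rw [hL]; positivity
  have hlL : lam ≤ L := by rw [hL]; apply Real.le_sqrt_of_sq_le; nlinarith
  have hNL : N ≤ L := by rw [hL]; apply Real.le_sqrt_of_sq_le; nlinarith
  have e1 : L ^ (d : ℝ) * (T * L) ^ ((1 - (d : ℝ)) / 2) =
      L ^ (((d : ℝ) + 1) / 2) * T ^ ((1 - (d : ℝ)) / 2) := by
    rw [Real.mul_rpow hT.le hL0.le, mul_left_comm, ← Real.rpow_add hL0]
    ring_nf
  have e2 : L ^ (d : ℝ) * ((T * L) ^ (-(d : ℝ) / 2) * (L / lam)) =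
      L ^ ((d : ℝ) / 2 + 1) * T ^ (-(d : ℝ) / 2) * lam⁻¹ := by
    rw [Real.mul_rpow hT.le hL0.le, Real.rpow_add hL0, Real.rpow_one,
      show (d : ℝ) = d / 2 + d / 2 by ring, Real.rpow_add hL0,
      show -((d : ℝ) / 2 + d / 2) / 2 = -(d / 2) by ring, Real.rpow_neg hL0.le,
      show ((d : ℝ) / 2 + d / 2) / 2 = d / 2 by ring]
    have : 0 < L ^ ((d : ℝ) / 2) := by positivity
    field_simp
  rw [e1] at b1
  rw [e2] at b2
  have h2 : ∀ x y : ℝ, x ≤ y → (2 : ℝ) ^ x ≤ 2 ^ y := fun x y h =>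
    Real.rpow_le_rpow_of_exponent_le one_le_two h
  rcases le_total N lam with hNl | hNl
  · have hLu : L ≤ 2 * lam := by
      rw [hL]; apply Real.sqrt_le_iff.2; constructor <;> nlinarith
    have b3 : k ≤ C * 2 ^ ((d : ℝ) + 1) * (lam ^ ((d : ℝ) / 2) * T ^ (-(d : ℝ) / 2)) := by
      calc k ≤ C * (L ^ ((d : ℝ) / 2 + 1) * T ^ (-(d : ℝ) / 2) * lam⁻¹) := b2
        _ ≤ C * ((2 * lam) ^ ((d : ℝ) / 2 + 1) * T ^ (-(d : ℝ) / 2) * lam⁻¹) := by gcongr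
        _ = C * 2 ^ ((d : ℝ) / 2 + 1) * (lam ^ ((d : ℝ) / 2) * T ^ (-(d : ℝ) / 2)) := by
          rw [Real.mul_rpow two_pos.le hl.le, Real.rpow_add hl, Real.rpow_one]
          field_simp
        _ ≤ _ := by gcongr <;> linarith
    have b4 : k ≤ C * 2 ^ ((d : ℝ) + 1) * N ^ (d : ℝ) := by
      refine b0.trans ?_
      gcongr
      exact le_mul_of_one_le_right hC.le (Real.one_le_rpow one_le_two (by linarith))
    -- For `N ≤ λ` one has `L ∼ λ`, so `b2` becomes `λ ^ (d / 2) T ^ (-d / 2)`. The trivial bound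
    -- gets weight `(1 - θ) / d`, the weight that produces `N ^ (1 - θ)`; the result is the first
    -- term.
    have hw0 : 0 ≤ (1 - θ) / d := by apply div_nonneg <;> linarith
    have hw1 : (1 - θ) / d ≤ 1 := by rw [div_le_one (by linarith)]; linarith
    have b5 := le_rpow_mul_rpow hk b3 b4 hw0 hw1
    set D := C * 2 ^ ((d : ℝ) + 1) with hD
    have hD0 : 0 < D := by positivity
    clear_value D
    have hfin : (D * (lam ^ ((d : ℝ) / 2) * T ^ (-(d : ℝ) / 2))) ^ (1 - (1 - θ) / d) *
        (D * N ^ (d : ℝ)) ^ ((1 - θ) / d) = D * T ^ (-(((d : ℝ) - 1 + θ) / 2)) *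
      (lam ^ (((d : ℝ) - 1 + θ) / 2) * N ^ (1 - θ)) := by
      rw [Real.mul_rpow hD0.le (by positivity), Real.mul_rpow hD0.le (by positivity),
        Real.mul_rpow (by positivity) (by positivity), ← Real.rpow_mul hl.le, ← Real.rpow_mul hT.le,
        ← Real.rpow_mul hN.le, mul_mul_mul_comm, ← Real.rpow_add hD0, sub_add_cancel, Real.rpow_one,
        show (d : ℝ) / 2 * (1 - (1 - θ) / d) = ((d : ℝ) - 1 + θ) / 2 by field_simp; ring,
        show -(d : ℝ) / 2 * (1 - (1 - θ) / d) = -(((d : ℝ) - 1 + θ) / 2) by field_simp; ring,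
        show (d : ℝ) * ((1 - θ) / d) = 1 - θ by field_simp]
      ring
    rw [hfin] at b5
    refine b5.trans ?_
    gcongr
    exact le_add_of_nonneg_right (by positivity)
  · have hLu : L ≤ 2 * N := by
      rw [hL]; apply Real.sqrt_le_iff.2; constructor <;> nlinarith
    have b3 : k ≤ C * 2 ^ ((d : ℝ) + 1) * (N ^ (((d : ℝ) + 1) / 2) * T ^ ((1 - (d : ℝ)) / 2)) := by
      calc k ≤ C * (L ^ (((d : ℝ) + 1) / 2) * T ^ ((1 - (d : ℝ)) / 2)) := b1
        _ ≤ C * ((2 * N) ^ (((d : ℝ) + 1) / 2) * T ^ ((1 - (d : ℝ)) / 2)) := by gcongr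
        _ = C * 2 ^ (((d : ℝ) + 1) / 2) * (N ^ (((d : ℝ) + 1) / 2) * T ^ ((1 - (d : ℝ)) / 2)) := by
          rw [Real.mul_rpow two_pos.le hN.le]
          ring
        _ ≤ _ := by gcongr <;> linarith
    have b4 : k ≤ C * 2 ^ ((d : ℝ) + 1) *
        (N ^ ((d : ℝ) / 2 + 1) * T ^ (-(d : ℝ) / 2) * lam ^ (-1 : ℝ)) := by
      calc k ≤ C * (L ^ ((d : ℝ) / 2 + 1) * T ^ (-(d : ℝ) / 2) * lam⁻¹) := b2
        _ ≤ C * ((2 * N) ^ ((d : ℝ) / 2 + 1) * T ^ (-(d : ℝ) / 2) * lam⁻¹) := by gcongr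
        _ = C * 2 ^ ((d : ℝ) / 2 + 1) *
            (N ^ ((d : ℝ) / 2 + 1) * T ^ (-(d : ℝ) / 2) * lam ^ (-1 : ℝ)) := by
          rw [Real.mul_rpow two_pos.le hN.le, Real.rpow_neg_one]
          ring
        _ ≤ _ := by gcongr <;> linarith
    -- For `λ ≤ N` one has `L ∼ N`, and the two decaying bounds with weights `1 - θ` and `θ` give
    -- the second term.
    have b5 := le_rpow_mul_rpow hk b3 b4 h0 h1
    set D := C * 2 ^ ((d : ℝ) + 1) with hD
    have hD0 : 0 < D := by positivity
    clear_value D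
    have hfin : (D * (N ^ (((d : ℝ) + 1) / 2) * T ^ ((1 - (d : ℝ)) / 2))) ^ (1 - θ) *
        (D * (N ^ ((d : ℝ) / 2 + 1) * T ^ (-(d : ℝ) / 2) * lam ^ (-1 : ℝ))) ^ θ =
        D * T ^ (-(((d : ℝ) - 1 + θ) / 2)) * (lam ^ (-θ) * N ^ (((d : ℝ) + 1 + θ) / 2)) := by
      rw [Real.mul_rpow hD0.le (by positivity), Real.mul_rpow hD0.le (by positivity),
        Real.mul_rpow (by positivity) (by positivity), Real.mul_rpow (by positivity) (by positivity),
        Real.mul_rpow (by positivity) (by positivity),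
        ← Real.rpow_mul hl.le, ← Real.rpow_mul hT.le, ← Real.rpow_mul hT.le,
        ← Real.rpow_mul hN.le, ← Real.rpow_mul hN.le, mul_mul_mul_comm, ← Real.rpow_add hD0,
        sub_add_cancel, Real.rpow_one,
        show ((d : ℝ) + 1 + θ) / 2 = ((d : ℝ) + 1) / 2 * (1 - θ) + (d / 2 + 1) * θ by ring,
        show -(((d : ℝ) - 1 + θ) / 2) = (1 - (d : ℝ)) / 2 * (1 - θ) + -d / 2 * θ by ring,
        Real.rpow_add hN, Real.rpow_add hT]
      ring_nf
    rw [hfin] at b5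
    refine b5.trans ?_
    gcongr
    exact le_add_of_nonneg_left (by positivity)

variable {d : ℕ}

/-- The unscaled profile of the dyadic block. -/
noncomputable def dyadicProfile (ψ : Space d → ℝ) (j : ℕ) : Space d → ℝ :=
  if j = 0 then ψ else annulusBump ψ

theorem dyadicSymbol_eq (ψ : Space d → ℝ) (j : ℕ) (ξ : Space d) :
    dyadicSymbol ψ j ξ = dyadicProfile ψ j (((2 : ℝ) ^ j)⁻¹ • ξ) := by
  unfold dyadicSymbol dyadicProfile
  split_ifs with h
  · simp [h]
  · rfl

theorem IsRadialBump.hasCompactSupport {ψ : Space d → ℝ} (h : IsRadialBump ψ) :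
    HasCompactSupport ψ := by
  rw [HasCompactSupport, h.tsupport_eq]; exact isCompact_closedBall _ _

theorem contDiff_dyadicProfile {ψ : Space d → ℝ} (h : IsRadialBump ψ) (j : ℕ) :
    ContDiff ℝ ∞ (dyadicProfile ψ j) := by
  unfold dyadicProfile
  split_ifs
  · exact h.smooth
  · exact h.smooth.sub (h.smooth.comp (contDiff_const_smul 2))

theorem hasCompactSupport_dyadicProfile {ψ : Space d → ℝ} (h : IsRadialBump ψ) (j : ℕ) :
    HasCompactSupport (dyadicProfile ψ j) := by
  unfold dyadicProfile
  split_ifs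
  · exact h.hasCompactSupport
  · exact h.hasCompactSupport.sub (h.hasCompactSupport.comp_smul two_ne_zero)

theorem half_le_norm_of_annulusBump_ne_zero {ψ : Space d → ℝ} (h : IsRadialBump ψ) {η : Space d}
    (hη : annulusBump ψ η ≠ 0) : 1 / 2 ≤ ‖η‖ := by
  by_contra! hlt
  apply hη
  rw [annulusBump, h.eq_one _ (by linarith), h.eq_one _ (by
    rw [norm_smul, Real.norm_of_nonneg two_pos.le]; linarith), sub_self]

/-- The symbol of `Δ_j U_λ(t)` in the normalization of Mathlib's Fourier transform. -/
noncomputable def blockSymbol (ψ : Space d → ℝ) (j : ℕ) (lam t : ℝ) (ξ : Space d) : ℂ :=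
  dyadicSymbol ψ j ((2 * Real.pi) • ξ) * propagatorSymbol lam t ((2 * Real.pi) • ξ)

/-- The change of variables `η = (2π / N) ξ` fixes the support of the cutoff. Taking `L` out of the
root normalizes the coefficients so that their squares sum to one, as `exists_norm_oscillatory_le`
requires. -/
theorem fourierInv_blockSymbol (ψ : Space d → ℝ) (j : ℕ) {lam : ℝ} (hl : 0 < lam) (t : ℝ) (x : Space d)
    {N L : ℝ} (hN : N = 2 ^ j) (hL : L = Real.sqrt (lam ^ 2 + N ^ 2)) :
    FourierTransformInv.fourierInv (blockSymbol ψ j lam t) x = ((N / (2 * Real.pi)) ^ d : ℝ) *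
      ∫ η : Space d, Complex.exp (Complex.I * (inner ℝ (N • x) η : ℝ)) * (dyadicProfile ψ j η *
        Complex.exp (Complex.I *
          ((t * L * Real.sqrt ((lam / L) ^ 2 + (N / L) ^ 2 * ‖η‖ ^ 2) : ℝ) : ℂ))) := by
  have hN0 : 0 < N := by rw [hN]; positivity
  have hL0 : 0 < L := by rw [hL]; positivity
  set h : Space d → ℂ := fun η => Complex.exp (Complex.I * (inner ℝ (N • x) η : ℝ)) *
    (dyadicProfile ψ j η * Complex.exp (Complex.I *
      ((t * L * Real.sqrt ((lam / L) ^ 2 + (N / L) ^ 2 * ‖η‖ ^ 2) : ℝ) : ℂ))) with hh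
  have h1 := Measure.integral_comp_smul (volume : Measure (Space d)) h (2 * Real.pi / N)
  have hp : 0 < 2 * Real.pi / N := by positivity
  rw [finrank_euclideanSpace_fin, abs_of_pos (by positivity), Complex.real_smul] at h1
  rw [show (N / (2 * Real.pi)) ^ d = ((2 * Real.pi / N) ^ d)⁻¹ by rw [← inv_pow, inv_div], ← h1,
    Real.fourierInv_eq']
  congr 1
  ext ξ
  rw [hh, blockSymbol, dyadicSymbol_eq, smul_eq_mul, propagatorSymbol, ← hN]
  simp only
  have e1 : (2 * Real.pi / N) • ξ = N⁻¹ • (2 * Real.pi) • ξ := by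
    rw [smul_smul]; congr 1; ring
  have e2 : (inner ℝ (N • x) ((2 * Real.pi / N) • ξ) : ℝ) = 2 * Real.pi * inner ℝ ξ x := by
    rw [inner_smul_left, inner_smul_right, real_inner_comm]
    simp only [conj_trivial]
    field_simp
  have e3 : L * Real.sqrt ((lam / L) ^ 2 + (N / L) ^ 2 * ‖(2 * Real.pi / N) • ξ‖ ^ 2) =
      Real.sqrt (lam ^ 2 + ‖(2 * Real.pi) • ξ‖ ^ 2) := by
    rw [norm_smul, norm_smul, Real.norm_of_nonneg hp.le, Real.norm_of_nonneg (by positivity)]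
    nth_rewrite 1 [← Real.sqrt_sq hL0.le]
    rw [← Real.sqrt_mul (by positivity)]
    congr 1
    field_simp
  rw [e2, mul_assoc t, e3, e1, mul_comm Complex.I ((2 * Real.pi * inner ℝ ξ x : ℝ) : ℂ)]

/-- The pointwise bound for the convolution kernel of `Δ_j U_λ(t)`. -/
theorem exists_norm_fourierInv_blockSymbol_le (hd : 1 ≤ d) {ψ : Space d → ℝ} (hψ : IsRadialBump ψ) :
    ∃ C : ℝ, 0 < C ∧ ∀ θ : ℝ, 0 ≤ θ → θ ≤ 1 → ∀ lam : ℝ, 1 < lam → ∀ t : ℝ, t ≠ 0 → ∀ (j : ℕ)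
      (x : Space d), ‖FourierTransformInv.fourierInv (blockSymbol ψ j lam t) x‖ ≤
        C * |t| ^ (-(((d : ℝ) - 1 + θ) / 2)) * (lam ^ (((d : ℝ) - 1 + θ) / 2) *
          ((2 : ℝ) ^ j) ^ (1 - θ) + lam ^ (-θ) * ((2 : ℝ) ^ j) ^ (((d : ℝ) + 1 + θ) / 2)) := by
  have hd' : (1 : ℝ) ≤ d := by exact_mod_cast hd
  have hfr : Module.finrank ℝ (Space d) = d := finrank_euclideanSpace_fin
  obtain ⟨CJ, hCJ, hJ⟩ := exists_norm_expSqrtTransform_le (V := Space d) (by rw [hfr]; exact hd)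
  rw [hfr] at hJ
  -- Only two profiles occur, one for `j = 0` and one for all `j ≥ 1`, so the constant does not
  -- depend on `j`.
  have hprof : ∃ C : ℝ, 0 ≤ C ∧ ∀ (j : ℕ) (μ ν τ : ℝ) (x : Space d), 0 < μ → 0 < ν →
      μ ^ 2 + ν ^ 2 = 1 → (∀ η, dyadicProfile ψ j η ≠ 0 → 1 / 4 ≤ μ ^ 2 + ν ^ 2 * ‖η‖ ^ 2) →
      ∀ M : ℝ, (∀ z : Space d, ‖expSqrtTransform (1 - τ / 2 * Complex.I) μ ν z‖ ≤ M) →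
      ‖∫ η : Space d, Complex.exp (Complex.I * (inner ℝ x η : ℝ)) * (dyadicProfile ψ j η *
        Complex.exp (Complex.I * ((τ * Real.sqrt (μ ^ 2 + ν ^ 2 * ‖η‖ ^ 2) : ℝ) : ℂ)))‖ ≤ C * M := by
    obtain ⟨C0, hC0, h0⟩ := exists_norm_oscillatory_le _ (contDiff_dyadicProfile hψ 0)
      (hasCompactSupport_dyadicProfile hψ 0)
    obtain ⟨C1, hC1, h1⟩ := exists_norm_oscillatory_le _ (contDiff_dyadicProfile hψ 1)
      (hasCompactSupport_dyadicProfile hψ 1)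
    refine ⟨C0 + C1, by positivity, fun j μ ν τ x hμ hν hμν hη M hM => ?_⟩
    have hM0 : 0 ≤ M := (norm_nonneg _).trans (hM 0)
    rcases Nat.eq_zero_or_pos j with rfl | hj
    · exact (h0 μ ν τ x hμ hν hμν hη M hM).trans (by nlinarith [mul_nonneg hC1 hM0])
    · have e : dyadicProfile ψ j = dyadicProfile ψ 1 := by
        simp [dyadicProfile, hj.ne']
      rw [e] at hη ⊢
      exact (h1 μ ν τ x hμ hν hμν hη M hM).trans (by nlinarith [mul_nonneg hC0 hM0])
  have htriv : ∃ C : ℝ, 0 ≤ C ∧ ∀ j, ∫ η : Space d, ‖dyadicProfile ψ j η‖ ≤ C := by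
    refine ⟨(∫ η : Space d, ‖dyadicProfile ψ 0 η‖) + ∫ η : Space d, ‖dyadicProfile ψ 1 η‖,
      by positivity, fun j => ?_⟩
    have n0 : 0 ≤ ∫ η : Space d, ‖dyadicProfile ψ 0 η‖ := by positivity
    have n1 : 0 ≤ ∫ η : Space d, ‖dyadicProfile ψ 1 η‖ := by positivity
    rcases Nat.eq_zero_or_pos j with rfl | hj
    · linarith
    · have e : dyadicProfile ψ j = dyadicProfile ψ 1 := by
        simp [dyadicProfile, hj.ne']
      rw [e]
      linarith
  obtain ⟨CI, hCI, hI⟩ := hprof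
  obtain ⟨CT, hCT, hT⟩ := htriv
  set D := CI * CJ * 2 ^ ((d : ℝ) / 2) + CT + 1 with hD
  have hD0 : 0 < D := by positivity
  refine ⟨D * 2 ^ ((d : ℝ) + 1), by positivity, fun θ hθ0 hθ1 lam hlam t ht j x => ?_⟩
  have hl : 0 < lam := by linarith
  have ht0 : 0 < |t| := abs_pos.2 ht
  set N : ℝ := 2 ^ j with hN
  have hN0 : 0 < N := by positivity
  have hN1 : 1 ≤ N := one_le_pow₀ one_le_two
  set L : ℝ := Real.sqrt (lam ^ 2 + N ^ 2) with hL
  have hL0 : 0 < L := by positivity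
  have hLsq : L ^ 2 = lam ^ 2 + N ^ 2 := Real.sq_sqrt (by positivity)
  have hμν : (lam / L) ^ 2 + (N / L) ^ 2 = 1 := by
    rw [div_pow, div_pow, ← add_div, ← hLsq, div_self (by positivity)]
  have hμ0 : 0 < lam / L := by positivity
  have hν0 : 0 < N / L := by positivity
  -- For `j = 0` the profile does not vanish near the origin, but then `N = 1 < λ` forces `(λ / L)²
  -- ≥ 1/2`. For `j ≥ 1` the support lies in `‖η‖ ≥ 1/2`.
  have hsupp : ∀ η, dyadicProfile ψ j η ≠ 0 → 1 / 4 ≤ (lam / L) ^ 2 + (N / L) ^ 2 * ‖η‖ ^ 2 := by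
    intro η hη
    by_cases hj : j = 0
    · have hN1' : N = 1 := by rw [hN, hj, pow_zero]
      have : (N / L) ^ 2 ≤ (lam / L) ^ 2 := by
        rw [hN1']; gcongr
      nlinarith [mul_nonneg (sq_nonneg (N / L)) (sq_nonneg ‖η‖)]
    · simp only [dyadicProfile, hj, if_false] at hη
      have h1 := half_le_norm_of_annulusBump_ne_zero hψ hη
      have h2 : (1 / 4 : ℝ) ≤ ‖η‖ ^ 2 := by nlinarith
      nlinarith [mul_le_mul_of_nonneg_left h2 (sq_nonneg (N / L)), sq_nonneg (lam / L)]
  set α : ℂ := 1 - (t * L : ℝ) / 2 * Complex.I with hα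
  have hαre : α.re = 1 := by simp [hα]
  have hαim : α.im = -(t * L / 2) := by simp [hα]
  -- The time decay enters only here, through the imaginary part of `α`; the powers of `‖α‖` used
  -- below are nonpositive.
  have hαn : |t| * L / 2 ≤ ‖α‖ := by
    refine le_trans (le_of_eq ?_) (Complex.abs_im_le_norm α)
    rw [hαim, abs_neg, abs_div, abs_mul, abs_of_pos hL0, abs_two]
  have hTL : 0 < |t| * L := by positivity
  have hαpow : ∀ s : ℝ, -(d : ℝ) / 2 ≤ s → s ≤ 0 →
      ‖α‖ ^ s ≤ 2 ^ ((d : ℝ) / 2) * (|t| * L) ^ s := by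
    intro s hs1 hs
    calc ‖α‖ ^ s ≤ (|t| * L / 2) ^ s := Real.rpow_le_rpow_of_nonpos (by positivity) hαn hs
      _ = 2 ^ (-s) * (|t| * L) ^ s := by
        rw [Real.div_rpow hTL.le two_pos.le, Real.rpow_neg two_pos.le]; ring
      _ ≤ _ := by
        gcongr
        · exact one_le_two
        · linarith
  set K := ‖FourierTransformInv.fourierInv (blockSymbol ψ j lam t) x‖ with hK
  set I : ℂ := ∫ η : Space d, Complex.exp (Complex.I * (inner ℝ (N • x) η : ℝ)) *
    (dyadicProfile ψ j η * Complex.exp (Complex.I *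
      ((t * L * Real.sqrt ((lam / L) ^ 2 + (N / L) ^ 2 * ‖η‖ ^ 2) : ℝ) : ℂ))) with hI'
  have hKI : K ≤ N ^ (d : ℝ) * ‖I‖ := by
    rw [hK, fourierInv_blockSymbol ψ j hl t x hN hL, norm_mul, Complex.norm_real,
      Real.norm_of_nonneg (by positivity), Real.rpow_natCast]
    gcongr
    apply div_le_self hN0.le
    linarith [Real.pi_gt_three]
  have hNL : N ^ (d : ℝ) * ((N / L) ^ d)⁻¹ = L ^ (d : ℝ) := by
    rw [Real.rpow_natCast, Real.rpow_natCast, div_pow]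
    field_simp
  have hmain : ∀ M : ℝ, (∀ z : Space d, ‖expSqrtTransform α (lam / L) (N / L) z‖ ≤ M) →
      ‖I‖ ≤ CI * M := fun M hM => hI j _ _ (t * L) (N • x) hμ0 hν0 hμν hsupp M hM
  refine dispersive_interpolation hd hD0 (norm_nonneg _) hN0 hl ht0 hL hθ0 hθ1 ?_ ?_ ?_
  · refine hKI.trans ?_
    have : ‖I‖ ≤ CT := by
      refine (norm_integral_le_integral_norm _).trans ((le_of_eq ?_).trans (hT j))
      congr 1
      ext η
      rw [norm_mul, norm_mul, mul_comm Complex.I, mul_comm Complex.I, Complex.norm_exp_ofReal_mul_I,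
        Complex.norm_exp_ofReal_mul_I, one_mul, mul_one, Complex.norm_real]
    rw [mul_comm]
    gcongr
    have : 0 ≤ CI * CJ * 2 ^ ((d : ℝ) / 2) := by positivity
    linarith
  · have h1 := hmain _ fun z => (hJ α (lam / L) (N / L) z hαre.ge hμ0 hν0).1
    have h2 := hαpow ((1 - (d : ℝ)) / 2) (by linarith) (by linarith)
    calc K ≤ N ^ (d : ℝ) * ‖I‖ := hKI
      _ ≤ N ^ (d : ℝ) * (CI * (CJ * (((N / L) ^ d)⁻¹ *
          (2 ^ ((d : ℝ) / 2) * (|t| * L) ^ ((1 - (d : ℝ)) / 2))))) := by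
        gcongr
        exact h1.trans (by gcongr)
      _ = CI * CJ * 2 ^ ((d : ℝ) / 2) * (L ^ (d : ℝ) * (|t| * L) ^ ((1 - (d : ℝ)) / 2)) := by
        rw [← hNL]; ring
      _ ≤ _ := by gcongr; linarith
  · have h1 := hmain _ fun z => (hJ α (lam / L) (N / L) z hαre.ge hμ0 hν0).2
    have h2 := hαpow (-(d : ℝ) / 2) (by linarith) (by linarith)
    calc K ≤ N ^ (d : ℝ) * ‖I‖ := hKI
      _ ≤ N ^ (d : ℝ) * (CI * (CJ * (((N / L) ^ d)⁻¹ *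
          (2 ^ ((d : ℝ) / 2) * (|t| * L) ^ (-(d : ℝ) / 2) * (lam / L)⁻¹)))) := by
        gcongr
        exact h1.trans (by gcongr)
      _ = CI * CJ * 2 ^ ((d : ℝ) / 2) *
          (L ^ (d : ℝ) * ((|t| * L) ^ (-(d : ℝ) / 2) * (L / lam))) := by
        rw [← hNL, inv_div]; ring
      _ ≤ _ := by gcongr; linarith

end

/-! ### From bounds on symbol and kernel to bounds between Lebesgue spaces. -/

section

variable {V : Type*} [NormedAddCommGroup V] [InnerProductSpace ℝ V] [FiniteDimensional ℝ V]
  [MeasurableSpace V] [BorelSpace V]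

theorem toTemperedDistribution_injective (p : ℝ≥0∞) [Fact (1 ≤ p)] :
    Function.Injective (Lp.toTemperedDistributionCLM ℂ (volume : Measure V) p) :=
  LinearMap.ker_eq_bot.1 Lp.ker_toTemperedDistributionCLM_eq_bot

/-- An operator on tempered distributions which is bounded from `L^p` to `L^q` on a dense subgroup
is bounded from `L^p` to `L^q`. -/
theorem exists_Lp_representative_of_dense {p q : ℝ≥0∞} [Fact (1 ≤ p)] [Fact (1 ≤ q)]
    (T : 𝓢'(V, ℂ) →L[ℂ] 𝓢'(V, ℂ)) (D : AddSubgroup (Lp ℂ p (volume : Measure V)))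
    (hD : Dense (D : Set (Lp ℂ p (volume : Measure V)))) {C : ℝ}
    (h : ∀ f ∈ D, ∃ g : Lp ℂ q (volume : Measure V), (g : 𝓢'(V, ℂ)) = T (f : 𝓢'(V, ℂ)) ∧
      ‖g‖ ≤ C * ‖f‖) (f : Lp ℂ p (volume : Measure V)) :
    ∃ g : Lp ℂ q (volume : Measure V), (g : 𝓢'(V, ℂ)) = T (f : 𝓢'(V, ℂ)) ∧ ‖g‖ ≤ C * ‖f‖ := by
  set ιp := Lp.toTemperedDistributionCLM ℂ (volume : Measure V) p with hιp
  set ιq := Lp.toTemperedDistributionCLM ℂ (volume : Measure V) q with hιq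
  obtain ⟨u, hu, hlim⟩ := mem_closure_iff_seq_limit.1 (hD f)
  choose g hg hgn using fun n => h (u n) (hu n)
  -- Representatives are unique, so the one supplied for `u n - u m` is `g n - g m`, and the
  -- sequence `g` is Cauchy.
  have hdiff : ∀ n m, ‖g n - g m‖ ≤ C * ‖u n - u m‖ := by
    intro n m
    obtain ⟨g', hg', hgn'⟩ := h (u n - u m) (D.sub_mem (hu n) (hu m))
    have : g' = g n - g m := by
      apply toTemperedDistribution_injective q
      rw [map_sub]
      change (g' : 𝓢'(V, ℂ)) = (g n : 𝓢'(V, ℂ)) - (g m : 𝓢'(V, ℂ))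
      rw [hg', hg, hg, ← map_sub]
      exact congrArg T (map_sub ιp _ _)
    rwa [this] at hgn'
  have hcau : CauchySeq g := by
    have hu' := hlim.cauchySeq
    rw [cauchySeq_iff_tendsto_dist_atTop_0] at hu' ⊢
    refine squeeze_zero (fun _ => dist_nonneg) (fun n => ?_) (by simpa using hu'.const_mul C)
    rw [dist_eq_norm, dist_eq_norm]
    exact hdiff _ _
  obtain ⟨g0, hg0⟩ := cauchySeq_tendsto_of_complete hcau
  refine ⟨g0, ?_, ?_⟩
  · have h1 : Tendsto (fun n => ιq (g n)) atTop (𝓝 (ιq g0)) := (ιq.continuous.tendsto g0).comp hg0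
    have h2 : Tendsto (fun n => T (ιp (u n))) atTop (𝓝 (T (ιp f))) :=
      ((T.continuous.comp ιp.continuous).tendsto f).comp hlim
    have h3 : (fun n => ιq (g n)) = fun n => T (ιp (u n)) := funext hg
    rw [h3] at h1
    exact tendsto_nhds_unique h1 h2
  · exact le_of_tendsto_of_tendsto hg0.norm (hlim.norm.const_mul C) (Eventually.of_forall hgn)

theorem exists_Lp_representative_of_schwartz {p q : ℝ≥0∞} [Fact (1 ≤ p)] [Fact (1 ≤ q)] (hp : p ≠ ⊤)
    {m : V → ℂ} (hm : m.HasTemperateGrowth) {C : ℝ}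
    (h : ∀ φ : 𝓢(V, ℂ), ‖(SchwartzMap.fourierMultiplierCLM ℂ m φ).toLp q (volume : Measure V)‖ ≤
      C * ‖φ.toLp p (volume : Measure V)‖) (f : Lp ℂ p (volume : Measure V)) :
    ∃ g : Lp ℂ q (volume : Measure V),
      (g : 𝓢'(V, ℂ)) = TemperedDistribution.fourierMultiplierCLM ℂ m (f : 𝓢'(V, ℂ)) ∧
      ‖g‖ ≤ C * ‖f‖ := by
  refine exists_Lp_representative_of_dense _
    (SchwartzMap.toLpCLM ℝ ℂ p (volume : Measure V)).toLinearMap.range.toAddSubgroup ?_ ?_ f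
  · exact SchwartzMap.denseRange_toLpCLM hp
  · rintro _ ⟨φ, rfl⟩
    refine ⟨(SchwartzMap.fourierMultiplierCLM ℂ m φ).toLp q volume, ?_, h φ⟩
    change _ = TemperedDistribution.fourierMultiplierCLM ℂ m
      (Lp.toTemperedDistribution (φ.toLp p (volume : Measure V)))
    rw [Lp.toTemperedDistribution_toLp_eq, Lp.toTemperedDistribution_toLp_eq,
      TemperedDistribution.fourierMultiplierCLM_toTemperedDistributionCLM_eq hm]

theorem exists_L2_representative {m : V → ℂ} (hm : m.HasTemperateGrowth) {B : ℝ}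
    (hB : ∀ ξ, ‖m ξ‖ ≤ B) (f : Lp ℂ 2 (volume : Measure V)) :
    ∃ g : Lp ℂ 2 (volume : Measure V),
      (g : 𝓢'(V, ℂ)) = TemperedDistribution.fourierMultiplierCLM ℂ m (f : 𝓢'(V, ℂ)) ∧
      ‖g‖ ≤ B * ‖f‖ := by
  refine exists_Lp_representative_of_schwartz (by simp) hm (fun φ => ?_) f
  rw [← SchwartzMap.norm_fourier_toL2_eq, ← SchwartzMap.norm_fourier_toL2_eq φ,
    SchwartzMap.fourierMultiplierCLM_apply, FourierTransform.fourier_fourierInv_eq]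
  refine Lp.norm_le_mul_norm_of_ae_le_mul ?_
  filter_upwards [SchwartzMap.coeFn_toLp (SchwartzMap.smulLeftCLM ℂ m (FourierTransform.fourier φ)) 2
    (volume : Measure V), SchwartzMap.coeFn_toLp (FourierTransform.fourier φ) 2
    (volume : Measure V)] with ξ h1 h2
  rw [h1, h2, SchwartzMap.smulLeftCLM_apply_apply hm, norm_smul]
  gcongr
  exact hB ξ

/-- This is the identity `∫ φ̂ g = ∫ φ ĝ` with `g(ξ) = exp (2π i ξ·x) m(ξ)`. Integrability of `m`
makes the kernel a bounded function, whose supremum then controls the norm from `L¹` to `L^∞`. -/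
theorem fourierMultiplierCLM_eq_convolution {m : V → ℂ} (hm : m.HasTemperateGrowth)
    (hi : Integrable m) (φ : 𝓢(V, ℂ)) (x : V) :
    SchwartzMap.fourierMultiplierCLM ℂ m φ x =
      ∫ y, φ y * FourierTransformInv.fourierInv m (x - y) := by
  set g : V → ℂ := fun ξ => Complex.exp (((2 * Real.pi * inner ℝ ξ x : ℝ) : ℂ) * Complex.I) * m ξ
    with hg
  have hgi : Integrable g := by
    refine hi.norm.mono' ?_ ?_
    · refine AEStronglyMeasurable.mul (Continuous.aestronglyMeasurable ?_) hi.aestronglyMeasurable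
      fun_prop
    · filter_upwards with ξ
      rw [hg, norm_mul, Complex.norm_exp_ofReal_mul_I, one_mul]
  have key := VectorFourier.integral_fourierIntegral_smul_eq_flip (L := innerₗ V) (μ := volume)
    (ν := volume) (f := φ) (g := g) Real.continuous_fourierChar
    (by exact continuous_inner) φ.integrable hgi
  rw [SchwartzMap.fourierMultiplierCLM_apply, SchwartzMap.fourierInv_coe, Real.fourierInv_eq']
  have h1 : ∀ ξ, Complex.exp (((2 * Real.pi * inner ℝ ξ x : ℝ) : ℂ) * Complex.I) •
      (SchwartzMap.smulLeftCLM ℂ m (FourierTransform.fourier φ)) ξ =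
      VectorFourier.fourierIntegral Real.fourierChar volume (innerₗ V) φ ξ • g ξ := by
    intro ξ
    rw [SchwartzMap.smulLeftCLM_apply_apply hm, SchwartzMap.fourier_coe]
    simp only [hg, smul_eq_mul]
    change _ = FourierTransform.fourier (φ : V → ℂ) ξ * _
    ring
  simp_rw [h1]
  rw [key]
  congr 1
  ext y
  rw [smul_eq_mul]
  congr 1
  rw [Real.fourierInv_eq']
  simp only [VectorFourier.fourierIntegral, Real.fourierChar_apply, Circle.smul_def]
  congr 1
  ext ξ
  simp only [hg, smul_eq_mul]
  rw [← mul_assoc, ← Complex.exp_add]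
  congr 2
  simp only [LinearMap.flip_apply, innerₗ_apply_apply, inner_sub_right]
  rw [real_inner_comm]
  push_cast
  ring

theorem exists_Linfty_representative {m : V → ℂ} (hm : m.HasTemperateGrowth) (hi : Integrable m)
    {B : ℝ} (hB : ∀ x, ‖FourierTransformInv.fourierInv m x‖ ≤ B)
    (f : Lp ℂ 1 (volume : Measure V)) :
    ∃ g : Lp ℂ ⊤ (volume : Measure V),
      (g : 𝓢'(V, ℂ)) = TemperedDistribution.fourierMultiplierCLM ℂ m (f : 𝓢'(V, ℂ)) ∧
      ‖g‖ ≤ B * ‖f‖ := by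
  refine exists_Lp_representative_of_schwartz (by simp) hm (fun φ => ?_) f
  have hB0 : 0 ≤ B := (norm_nonneg _).trans (hB 0)
  rw [SchwartzMap.norm_toLp_one, SchwartzMap.norm_toLp]
  refine ENNReal.toReal_le_of_le_ofReal (by positivity) ?_
  rw [eLpNorm_exponent_top]
  refine eLpNormEssSup_le_of_ae_bound (Eventually.of_forall fun x => ?_)
  rw [fourierMultiplierCLM_eq_convolution hm hi, ← integral_const_mul]
  refine norm_integral_le_of_norm_le (φ.integrable.norm.const_mul B) ?_
  filter_upwards with y
  rw [norm_mul, mul_comm]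
  gcongr
  exact hB _

end

/-! ### The Riesz–Thorin inequality for finite matrices. -/

/-- `z ↦ sgn(a) |a| ^ (q (1 + z) / 2)`. -/
noncomputable def powerFamily (q : ℝ) (a : ℂ) (z : ℂ) : ℂ :=
  a / ‖a‖ * (‖a‖ : ℂ) ^ ((q : ℂ) * (1 + z) / 2)

theorem re_power_exponent (q : ℝ) (z : ℂ) : ((q : ℂ) * (1 + z) / 2).re = q * (1 + z.re) / 2 := by
  rw [Complex.div_ofNat_re, Complex.re_ofReal_mul]
  simp

theorem norm_powerFamily {q : ℝ} (hq : 0 < q) (a : ℂ) {z : ℂ} (hz : 0 ≤ z.re) :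
    ‖powerFamily q a z‖ = ‖a‖ ^ (q * (1 + z.re) / 2) := by
  have hpos : 0 < q * (1 + z.re) / 2 := by positivity
  rcases eq_or_ne a 0 with rfl | ha
  · simp [powerFamily, Real.zero_rpow hpos.ne']
  · have ha' : ‖a‖ ≠ 0 := norm_ne_zero_iff.2 ha
    rw [powerFamily, norm_mul, norm_div, Complex.norm_real, norm_norm, div_self ha', one_mul,
      Complex.norm_cpow_eq_rpow_re_of_nonneg (norm_nonneg _) (by rw [re_power_exponent]; exact hpos.ne'),
      re_power_exponent]

theorem differentiableAt_powerFamily {q : ℝ} (hq : 0 < q) (a : ℂ) {z : ℂ} (hz : 0 ≤ z.re) :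
    DifferentiableAt ℂ (powerFamily q a) z := by
  have hpos : 0 < q * (1 + z.re) / 2 := by positivity
  refine DifferentiableAt.const_mul (DifferentiableAt.const_cpow (by fun_prop) (Or.inr ?_)) _
  intro h
  have := congrArg Complex.re h
  rw [re_power_exponent] at this
  simp at this
  rcases this with h | h <;> linarith

theorem powerFamily_self {q : ℝ} (hq : 0 < q) (a : ℂ) :
    powerFamily q a ((2 / q - 1 : ℝ) : ℂ) = a := by
  have h1 : ((q : ℂ) * (1 + ((2 / q - 1 : ℝ) : ℂ)) / 2) = 1 := by
    have : (q : ℂ) ≠ 0 := by exact_mod_cast hq.ne'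
    push_cast
    field_simp
    ring
  rw [powerFamily, h1, Complex.cpow_one]
  rcases eq_or_ne a 0 with rfl | ha
  · simp
  · have ha' : (‖a‖ : ℂ) ≠ 0 := by exact_mod_cast norm_ne_zero_iff.2 ha
    field_simp

/-- The Riesz–Thorin theorem between `(1, ∞)` and `(2, 2)` for a matrix on weighted finite sets. -/
theorem riesz_thorin_finite {ι κ : Type*} [Fintype ι] [Fintype κ] (s : ι → ℝ) (r : κ → ℝ)
    (hs : ∀ i, 0 ≤ s i) (hr : ∀ j, 0 ≤ r j) (B : ι → κ → ℂ) {M1 M2 : ℝ} (hM1 : 0 ≤ M1)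
    (hM2 : 0 ≤ M2)
    (h1 : ∀ (c : ι → ℂ) (e : κ → ℂ), ‖∑ i, ∑ j, c i * e j * B i j‖ ≤
      M1 * ((∑ i, ‖c i‖ * s i) * ∑ j, ‖e j‖ * r j))
    (h2 : ∀ (c : ι → ℂ) (e : κ → ℂ), ‖∑ i, ∑ j, c i * e j * B i j‖ ≤
      M2 * ((∑ i, ‖c i‖ ^ (2 : ℝ) * s i) * ∑ j, ‖e j‖ ^ (2 : ℝ) * r j) ^ (1 / 2 : ℝ))
    {q : ℝ} (hq1 : 1 ≤ q) (hq2 : q ≤ 2) (a : ι → ℂ) (b : κ → ℂ) :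
    ‖∑ i, ∑ j, a i * b j * B i j‖ ≤ M2 ^ (2 - 2 / q) * M1 ^ (2 / q - 1) *
      ((∑ i, ‖a i‖ ^ q * s i) * ∑ j, ‖b j‖ ^ q * r j) ^ (1 / q) := by
  have hq0 : 0 < q := by linarith
  set P := (∑ i, ‖a i‖ ^ q * s i) * ∑ j, ‖b j‖ ^ q * r j with hP
  have hP0 : 0 ≤ P := mul_nonneg
    (Finset.sum_nonneg fun i _ => mul_nonneg (by positivity) (hs i))
    (Finset.sum_nonneg fun j _ => mul_nonneg (by positivity) (hr j))
  -- The moduli of the coefficients are `‖a‖ ^ (q / 2)` on `Re z = 0` and `‖a‖ ^ q` on `Re z = 1`,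
  -- so both hypotheses see the same quantity `P`. The original coefficients are recovered at `z = 2
  -- / q - 1`.
  let F : ℂ → ℂ := fun z => ∑ i, ∑ j, powerFamily q (a i) z * powerFamily q (b j) z * B i j
  have hη0 : 0 ≤ 2 / q - 1 := by rw [sub_nonneg, le_div_iff₀ hq0]; linarith
  have hη1 : 2 / q - 1 ≤ 1 := by rw [sub_le_iff_le_add, div_le_iff₀ hq0]; linarith
  have hdiff : ∀ z : ℂ, 0 ≤ z.re → DifferentiableAt ℂ F z := by
    intro z hz
    refine DifferentiableAt.fun_sum fun i _ => DifferentiableAt.fun_sum fun j _ => ?_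
    exact ((differentiableAt_powerFamily hq0 _ hz).mul
      (differentiableAt_powerFamily hq0 _ hz)).mul_const _
  have hclosed : IsClosed (Complex.HadamardThreeLines.verticalClosedStrip 0 1) :=
    isClosed_Icc.preimage Complex.continuous_re
  have hd : DiffContOnCl ℂ F (Complex.HadamardThreeLines.verticalStrip 0 1) := by
    refine DifferentiableOn.diffContOnCl fun z hz => (hdiff z ?_).differentiableWithinAt
    have hsub : Complex.HadamardThreeLines.verticalStrip 0 1 ⊆
        Complex.HadamardThreeLines.verticalClosedStrip 0 1 := preimage_mono Ioo_subset_Icc_self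
    exact (hclosed.closure_subset_iff.2 hsub hz).1
  have hbdd : BddAbove (norm ∘ F '' Complex.HadamardThreeLines.verticalClosedStrip 0 1) := by
    refine ⟨∑ i, ∑ j, (1 + ‖a i‖) ^ q * (1 + ‖b j‖) ^ q * ‖B i j‖, ?_⟩
    rintro _ ⟨z, hz, rfl⟩
    have hz0 : 0 ≤ z.re := hz.1
    have hz1 : z.re ≤ 1 := hz.2
    have hpow : ∀ c : ℂ, ‖powerFamily q c z‖ ≤ (1 + ‖c‖) ^ q := by
      intro c
      rw [norm_powerFamily hq0 c hz0]
      have hn := norm_nonneg c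
      calc ‖c‖ ^ (q * (1 + z.re) / 2) ≤ (1 + ‖c‖) ^ (q * (1 + z.re) / 2) := by
            gcongr; linarith
        _ ≤ (1 + ‖c‖) ^ q := by
            apply Real.rpow_le_rpow_of_exponent_le (by linarith)
            nlinarith
    refine norm_sum_le_of_le _ fun i _ => norm_sum_le_of_le _ fun j _ => ?_
    rw [norm_mul, norm_mul]
    gcongr
    · exact hpow _
    · exact hpow _
  have hleft : ∀ z ∈ Complex.re ⁻¹' {(0 : ℝ)}, ‖F z‖ ≤ M2 * P ^ (1 / 2 : ℝ) := by
    intro z hz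
    have hz : z.re = 0 := hz
    refine (h2 _ _).trans (le_of_eq ?_)
    have e : ∀ c : ℂ, ‖powerFamily q c z‖ ^ (2 : ℝ) = ‖c‖ ^ q := by
      intro c
      rw [norm_powerFamily hq0 c hz.ge, ← Real.rpow_mul (norm_nonneg _), hz]
      congr 1
      ring
    simp_rw [e]
    rfl
  have hright : ∀ z ∈ Complex.re ⁻¹' {(1 : ℝ)}, ‖F z‖ ≤ M1 * P := by
    intro z hz
    have hz : z.re = 1 := hz
    refine (h1 _ _).trans (le_of_eq ?_)
    have e : ∀ c : ℂ, ‖powerFamily q c z‖ = ‖c‖ ^ q := by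
      intro c
      rw [norm_powerFamily hq0 c (by rw [hz]; exact zero_le_one), hz]
      congr 1
      ring
    simp_rw [e]
    rfl
  have key := Complex.HadamardThreeLines.norm_le_interp_of_mem_verticalClosedStrip' (f := F)
    (z := ((2 / q - 1 : ℝ) : ℂ)) zero_lt_one ⟨by simpa using hη0, by simpa using hη1⟩
    hd hbdd hleft hright
  simp only [F, powerFamily_self hq0, Complex.ofReal_re, sub_zero, div_one] at key
  refine key.trans (le_of_eq ?_)
  rw [Real.mul_rpow hM2 (by positivity), Real.mul_rpow hM1 hP0, ← Real.rpow_mul hP0,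
    mul_mul_mul_comm, show 1 - (2 / q - 1) = 2 - 2 / q by ring]
  congr 1
  -- The exponents of `P` add to `(1 - 1 / q) + (2 / q - 1) = 1 / q`; since `P` may vanish, they
  -- must be known to be nonnegative.
  have e1 : 1 / 2 * (2 - 2 / q) = 1 - 1 / q := by ring
  have hq' : 0 ≤ 1 - 1 / q := by
    rw [sub_nonneg, div_le_one hq0]; exact hq1
  rw [e1, ← Real.rpow_add_of_nonneg hP0 hq' hη0]
  congr 1
  ring

/-! ### Step functions and the Hölder pairing. -/

section

section StepFunctions

variable {X : Type*} [MeasurableSpace X] {μ : Measure X} {ι : Type*} [Fintype ι]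

/-- The step function with value `c i` on the set `A i`, as an element of `L^p`. -/
noncomputable def stepLp (p : ℝ≥0∞) {A : ι → Set X} (hA : ∀ i, MeasurableSet (A i))
    (hfin : ∀ i, μ (A i) ≠ ⊤) (c : ι → ℂ) : Lp ℂ p μ :=
  ∑ i, c i • indicatorConstLp p (hA i) (hfin i) (1 : ℂ)

omit [Fintype ι] in
theorem coeFn_finset_sum {p : ℝ≥0∞} (s : Finset ι) (f : ι → Lp ℂ p μ) :
    ⇑(∑ i ∈ s, f i) =ᵐ[μ] fun x => ∑ i ∈ s, f i x := by
  classical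
  induction s using Finset.induction_on with
  | empty =>
    simp only [Finset.sum_empty]
    exact Lp.coeFn_zero ℂ p μ
  | insert i s hi ih =>
    rw [Finset.sum_insert hi]
    filter_upwards [Lp.coeFn_add (f i) (∑ i ∈ s, f i), ih] with x h1 h2
    rw [h1, Pi.add_apply, h2, Finset.sum_insert hi]

theorem coeFn_linearCombination {p : ℝ≥0∞} (c : ι → ℂ) (f : ι → Lp ℂ p μ) :
    ⇑(∑ i, c i • f i) =ᵐ[μ] fun x => ∑ i, c i * f i x := by
  have h : ∀ᵐ x ∂μ, ∀ i, (c i • f i) x = c i * f i x := by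
    rw [ae_all_iff]
    intro i
    filter_upwards [Lp.coeFn_smul (c i) (f i)] with x hx
    rw [hx]; rfl
  filter_upwards [coeFn_finset_sum Finset.univ (fun i => c i • f i), h] with x h1 h2
  rw [h1]
  exact Finset.sum_congr rfl fun i _ => h2 i

theorem coeFn_stepLp (p : ℝ≥0∞) {A : ι → Set X} (hA : ∀ i, MeasurableSet (A i))
    (hfin : ∀ i, μ (A i) ≠ ⊤) (c : ι → ℂ) :
    stepLp p hA hfin c =ᵐ[μ] fun x => ∑ i, c i * (A i).indicator (fun _ => (1 : ℂ)) x := by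
  have h : ∀ᵐ x ∂μ, ∀ i, indicatorConstLp p (hA i) (hfin i) (1 : ℂ) x =
      (A i).indicator (fun _ => (1 : ℂ)) x := by
    rw [ae_all_iff]
    exact fun i => indicatorConstLp_coeFn
  filter_upwards [coeFn_linearCombination c (fun i => indicatorConstLp p (hA i) (hfin i) (1 : ℂ)), h]
    with x h1 h2
  rw [stepLp, h1]
  exact Finset.sum_congr rfl fun i _ => by rw [h2 i]

theorem norm_stepLp_rpow {p : ℝ≥0∞} (hp0 : p ≠ 0) (hp : p ≠ ⊤) {A : ι → Set X}
    (hA : ∀ i, MeasurableSet (A i)) (hfin : ∀ i, μ (A i) ≠ ⊤)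
    (hdisj : Pairwise (Function.onFun Disjoint A)) (c : ι → ℂ) :
    ‖stepLp p hA hfin c‖ = (∑ i, ‖c i‖ ^ p.toReal * μ.real (A i)) ^ (1 / p.toReal) := by
  have hpr : 0 < p.toReal := ENNReal.toReal_pos hp0 hp
  rw [Lp.norm_def, (Lp.memLp _).eLpNorm_eq_integral_rpow_norm hp0 hp,
    ENNReal.toReal_ofReal (by positivity), one_div]
  congr 1
  have h : (fun x => ‖stepLp p hA hfin c x‖ ^ p.toReal) =ᵐ[μ]
      fun x => ∑ i, (A i).indicator (fun _ => ‖c i‖ ^ p.toReal) x := by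
    filter_upwards [coeFn_stepLp p hA hfin c] with x hx
    rw [hx]
    by_cases hex : ∃ i, x ∈ A i
    · obtain ⟨i, hi⟩ := hex
      have hne : ∀ j, j ≠ i → x ∉ A j := fun j hj hxj =>
        Set.disjoint_left.1 (hdisj hj) hxj hi
      rw [Finset.sum_eq_single i, Finset.sum_eq_single i]
      · simp [hi]
      · intro j _ hj; simp [hne j hj]
      · simp
      · intro j _ hj; simp [hne j hj]
      · simp
    · push Not at hex
      simp [hex, Real.zero_rpow hpr.ne']
  rw [integral_congr_ae h, integral_finsetSum]
  · refine Finset.sum_congr rfl fun i _ => ?_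
    rw [integral_indicator_const _ (hA i), smul_eq_mul, mul_comm]
  · intro i _
    exact (integrable_indicator_iff (hA i)).2 (integrableOn_const (hfin i))

/-- Every simple function in `L^p` is a step function on finitely many disjoint sets. -/
theorem exists_eq_stepLp {p : ℝ≥0∞} (hp0 : p ≠ 0) (hp : p ≠ ⊤) (f : Lp.simpleFunc ℂ p μ) :
    ∃ (n : ℕ) (A : Fin n → Set X) (hA : ∀ i, MeasurableSet (A i)) (hfin : ∀ i, μ (A i) ≠ ⊤)
      (c : Fin n → ℂ), Pairwise (Function.onFun Disjoint A) ∧ (f : Lp ℂ p μ) = stepLp p hA hfin c := by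
  set g := Lp.simpleFunc.toSimpleFunc f with hg
  -- The value zero is dropped because its fibre may have infinite measure.
  set S := g.range.filter (· ≠ 0) with hS
  let e := S.equivFin
  let c : Fin S.card → ℂ := fun i => (e.symm i : ℂ)
  have hcS : ∀ i, c i ∈ S := fun i => (e.symm i).2
  have hcinj : Function.Injective c := Subtype.val_injective.comp e.symm.injective
  refine ⟨S.card, fun i => g ⁻¹' {c i}, fun i => g.measurableSet_fiber _, fun i => ?_, c, ?_, ?_⟩
  · exact (SimpleFunc.measure_preimage_lt_top_of_memLp hp0 hp g (Lp.simpleFunc.memLp f) _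
      (Finset.mem_filter.1 (hcS i)).2).ne
  · intro i j hij
    refine Set.disjoint_left.2 fun x hx hx' => hij (hcinj ?_)
    exact (show g x = c i from hx).symm.trans hx'
  · apply Lp.ext
    refine (Lp.simpleFunc.toSimpleFunc_eq_toFun f).symm.trans (EventuallyEq.trans ?_
      (coeFn_stepLp p _ _ c).symm)
    refine Eventually.of_forall fun x => ?_
    change g x = ∑ i, c i * (g ⁻¹' {c i}).indicator (fun _ => (1 : ℂ)) x
    by_cases h0 : g x = 0
    · rw [h0, Finset.sum_eq_zero]
      intro i _
      rw [indicator_of_notMem, mul_zero]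
      intro hx
      have hx : g x = c i := hx
      exact (Finset.mem_filter.1 (hcS i)).2 (hx ▸ h0)
    · have hmem : g x ∈ S := Finset.mem_filter.2 ⟨g.mem_range_self x, h0⟩
      have hc : c (e ⟨g x, hmem⟩) = g x := by simp [c]
      rw [Finset.sum_eq_single (e ⟨g x, hmem⟩)]
      · rw [indicator_of_mem (by exact hc.symm), hc, mul_one]
      · intro j _ hj
        rw [indicator_of_notMem, mul_zero]
        intro hx
        have hx : g x = c j := hx
        exact hj (hcinj (hx.symm.trans hc.symm))
      · simp

end StepFunctions

section Pairing

variable {X : Type*} [MeasurableSpace X] {μ : Measure X}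

theorem norm_integral_mul_le {p q : ℝ≥0∞} [Fact (1 ≤ p)] [Fact (1 ≤ q)] [p.HolderConjugate q]
    (f : Lp ℂ p μ) (g : Lp ℂ q μ) : ‖∫ x, f x * g x ∂μ‖ ≤ ‖f‖ * ‖g‖ := by
  set h : Lp ℂ 1 μ := (ContinuousLinearMap.mul ℂ ℂ).holder 1 f g
  have h1 : ∫ x, f x * g x ∂μ = ∫ x, h x ∂μ :=
    (integral_congr_ae ((ContinuousLinearMap.mul ℂ ℂ).coeFn_holder f g)).symm
  rw [h1]
  calc ‖∫ x, h x ∂μ‖ ≤ ∫ x, ‖h x‖ ∂μ := norm_integral_le_integral_norm _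
    _ = ‖h‖ := (L1.norm_eq_integral_norm h).symm
    _ ≤ ‖ContinuousLinearMap.mul ℂ ℂ‖ * ‖f‖ * ‖g‖ :=
      (ContinuousLinearMap.mul ℂ ℂ).norm_holder_apply_apply_le f g
    _ ≤ ‖f‖ * ‖g‖ := by
      rw [mul_assoc]
      exact mul_le_of_le_one_left (by positivity) (ContinuousLinearMap.opNorm_mul_le ℂ ℂ)

theorem continuous_integral_mul {p q : ℝ≥0∞} [Fact (1 ≤ p)] [Fact (1 ≤ q)] [p.HolderConjugate q]
    (f : Lp ℂ p μ) : Continuous fun g : Lp ℂ q μ => ∫ x, f x * g x ∂μ := by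
  have h1 := (ContinuousLinearMap.mul ℂ ℂ).lpPairing_eq_integral (μ := μ) (p := p) (q := q) f
  simp only [ContinuousLinearMap.mul_apply'] at h1
  simp_rw [← h1]
  fun_prop

end Pairing

end

/-! ### Duality, and comparison of representatives in different Lebesgue spaces. -/

section

section Duality

variable {X : Type*} [MeasurableSpace X] {μ : Measure X}

/-- The norm in `L^p` is detected by pairing with simple functions. -/
theorem norm_le_of_integral_mul_simpleFunc_le {p q : ℝ≥0∞} [Fact (1 ≤ p)] [Fact (1 ≤ q)]
    [hpq : p.HolderConjugate q] (hp1 : 1 < p) (hp : p ≠ ⊤) (G : Lp ℂ p μ) {K : ℝ} (hK0 : 0 ≤ K)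
    (hK : ∀ h : Lp.simpleFunc ℂ q μ, ‖∫ x, G x * (h : Lp ℂ q μ) x ∂μ‖ ≤ K * ‖(h : Lp ℂ q μ)‖) :
    ‖G‖ ≤ K := by
  have hp0 : p ≠ 0 := (zero_lt_one.trans hp1).ne'
  set r := p.toReal with hr
  have hr1 : 1 < r := by
    rw [hr, ← ENNReal.toReal_one]
    exact (ENNReal.toReal_lt_toReal ENNReal.one_ne_top hp).2 hp1
  have hq : q ≠ ⊤ := by
    intro h
    have := hpq.inv_add_inv_eq_one
    rw [h, ENNReal.inv_top, add_zero, ENNReal.inv_eq_one] at this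
    exact hp1.ne' this
  have hext : ∀ h : Lp ℂ q μ, ‖∫ x, G x * h x ∂μ‖ ≤ K * ‖h‖ := by
    intro h
    refine (Lp.simpleFunc.denseRange (E := ℂ) (μ := μ) hq).induction_on
      (p := fun h : Lp ℂ q μ => ‖∫ x, G x * h x ∂μ‖ ≤ K * ‖h‖) h ?_ hK
    exact isClosed_le (continuous_integral_mul G).norm (by fun_prop)
  -- The extremal function in Hölder's inequality: `G h0 = ‖G‖ ^ r` pointwise, and `‖h0‖ = ‖G‖ ^ (r
  -- - 1)` has its `L^q` norm equal to `‖G‖_p ^ (r - 1)`.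
  let h0 : X → ℂ := fun x => (starRingEnd ℂ) (G x) * ((‖G x‖ ^ (r - 2) : ℝ) : ℂ)
  have hGm : AEStronglyMeasurable G μ := (Lp.memLp G).1
  have hm : AEStronglyMeasurable h0 μ := by
    have h1 : AEMeasurable G μ := hGm.aemeasurable
    have : AEMeasurable h0 μ := by fun_prop
    exact this.aestronglyMeasurable
  have hn : ∀ x, ‖h0 x‖ = ‖G x‖ ^ (r - 1) := by
    intro x
    rcases eq_or_ne (G x) 0 with h | h
    · simp [h0, h, Real.zero_rpow (show r - 1 ≠ 0 by linarith)]
    · have hpos : 0 < ‖G x‖ := norm_pos_iff.2 h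
      rw [norm_mul, RCLike.norm_conj, Complex.norm_real, Real.norm_of_nonneg (by positivity)]
      nth_rewrite 1 [← Real.rpow_one ‖G x‖]
      rw [← Real.rpow_add hpos]
      ring_nf
  have hqp : q * ENNReal.ofReal (r - 1) = p := by
    have hq0 : q ≠ 0 := (zero_lt_one.trans_le (Fact.out : 1 ≤ q)).ne'
    have h1 := congrArg ENNReal.toReal hpq.inv_add_inv_eq_one
    rw [ENNReal.toReal_add (ENNReal.inv_ne_top.2 hp0) (ENNReal.inv_ne_top.2 hq0), ENNReal.toReal_inv,
      ENNReal.toReal_inv, ENNReal.toReal_one] at h1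
    have hqr : 0 < q.toReal := ENNReal.toReal_pos hq0 hq
    rw [← ENNReal.toReal_eq_toReal_iff' (ENNReal.mul_ne_top hq ENNReal.ofReal_ne_top) hp,
      ENNReal.toReal_mul, ENNReal.toReal_ofReal (by linarith)]
    rw [← hr] at h1 ⊢
    have hr0 : r ≠ 0 := by linarith
    field_simp at h1
    linarith
  have hnorm : eLpNorm h0 q μ = eLpNorm G p μ ^ (r - 1) := by
    rw [← eLpNorm_norm]
    simp_rw [hn]
    rw [eLpNorm_norm_rpow _ (by linarith), hqp]
  have hmem : MemLp h0 q μ := by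
    refine ⟨hm, ?_⟩
    rw [hnorm]
    exact ENNReal.rpow_lt_top_of_nonneg (by linarith) (Lp.eLpNorm_ne_top G)
  set H : Lp ℂ q μ := hmem.toLp h0 with hH
  have key := hext H
  have e1 : ‖H‖ = ‖G‖ ^ (r - 1) := by
    rw [hH, Lp.norm_toLp, hnorm, Lp.norm_def, ENNReal.toReal_rpow]
  have e2 : ∫ x, G x * H x ∂μ = ((‖G‖ ^ r : ℝ) : ℂ) := by
    have h1 : ∫ x, G x * H x ∂μ = ∫ x, ((‖G x‖ ^ r : ℝ) : ℂ) ∂μ := by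
      refine integral_congr_ae ?_
      filter_upwards [hmem.coeFn_toLp] with x hx
      rw [hH, hx]
      simp only [h0]
      rcases eq_or_ne (G x) 0 with h | h
      · simp [h, Real.zero_rpow (show r ≠ 0 by linarith)]
      · have hpos : 0 < ‖G x‖ := norm_pos_iff.2 h
        rw [← mul_assoc, Complex.mul_conj, Complex.normSq_eq_norm_sq, ← Complex.ofReal_mul,
          ← Real.rpow_natCast, ← Real.rpow_add hpos]
        congr 2
        push_cast
        ring
    refine h1.trans (integral_complex_ofReal.trans (congrArg Complex.ofReal ?_))
    have hI : 0 ≤ ∫ x, ‖G x‖ ^ r ∂μ := integral_nonneg fun x => by positivity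
    rw [Lp.norm_def, (Lp.memLp G).eLpNorm_eq_integral_rpow_norm hp0 hp, ENNReal.toReal_ofReal
      (by positivity), ← hr, ← Real.rpow_mul hI, inv_mul_cancel₀ (by linarith), Real.rpow_one]
  rw [e1, e2, Complex.norm_real, Real.norm_of_nonneg (by positivity)] at key
  rcases (norm_nonneg G).eq_or_lt with h | h
  · rw [← h]; exact hK0
  · have h2 : ‖G‖ ^ r = ‖G‖ * ‖G‖ ^ (r - 1) := by
      nth_rewrite 2 [← Real.rpow_one ‖G‖]
      rw [← Real.rpow_add h]
      ring_nf
    rw [h2] at key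
    exact le_of_mul_le_mul_right key (by positivity)

/-- Almost everywhere `‖f‖ ^ r ≤ B ^ (r - 2) ‖f‖ ^ 2`, with `B` the essential supremum. -/
theorem memLp_of_memLp_two_of_memLp_top {f : X → ℂ} (h2 : MemLp f 2 μ) (ht : MemLp f ⊤ μ)
    {p : ℝ≥0∞} (hp2 : 2 ≤ p) (hp : p ≠ ⊤) : MemLp f p μ := by
  have hp0 : p ≠ 0 := (two_pos.trans_le hp2).ne'
  rw [← integrable_norm_rpow_iff h2.1 hp0 hp]
  set r := p.toReal with hr
  have hr2 : 2 ≤ r := by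
    have := (ENNReal.toReal_le_toReal (by simp) hp).2 hp2
    simpa using this
  set B := (eLpNorm f ⊤ μ).toReal
  have hB : ∀ᵐ x ∂μ, ‖f x‖ ≤ B := by
    have h1 : ∀ᵐ x ∂μ, ‖f x‖ₑ ≤ eLpNorm f ⊤ μ := by
      rw [eLpNorm_exponent_top]; exact enorm_ae_le_eLpNormEssSup f μ
    filter_upwards [h1] with x hx
    rw [← toReal_enorm]
    exact ENNReal.toReal_mono ht.eLpNorm_ne_top hx
  have hi := (integrable_norm_rpow_iff h2.1 two_ne_zero ENNReal.ofNat_ne_top).2 h2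
  refine (hi.const_mul (B ^ (r - 2))).mono' ?_ ?_
  · have := h2.1.aemeasurable
    exact AEMeasurable.aestronglyMeasurable (by fun_prop)
  · filter_upwards [hB] with x hx
    rw [Real.norm_of_nonneg (by positivity), ENNReal.toReal_ofNat]
    calc ‖f x‖ ^ r = ‖f x‖ ^ (r - 2) * ‖f x‖ ^ (2 : ℝ) := by
          rw [← Real.rpow_add_of_nonneg (norm_nonneg _) (by linarith) two_pos.le]; ring_nf
      _ ≤ _ := by gcongr

end Duality

variable {V : Type*} [NormedAddCommGroup V] [InnerProductSpace ℝ V] [FiniteDimensional ℝ V]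
  [MeasurableSpace V] [BorelSpace V]

theorem toTemperedDistribution_congr {p q : ℝ≥0∞} [Fact (1 ≤ p)] [Fact (1 ≤ q)]
    {f : Lp ℂ p (volume : Measure V)} {g : Lp ℂ q (volume : Measure V)} (h : f =ᵐ[volume] g) :
    (f : 𝓢'(V, ℂ)) = (g : 𝓢'(V, ℂ)) := by
  ext φ
  rw [Lp.toTemperedDistribution_apply, Lp.toTemperedDistribution_apply]
  refine integral_congr_ae ?_
  filter_upwards [h] with x hx
  rw [hx]

/-- Both functions are locally integrable, so testing against smooth compactly supported functions
suffices. It identifies the `L²` and `L^∞` outputs of one operator as the same function. -/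
theorem ae_eq_of_toTemperedDistribution_eq {p q : ℝ≥0∞} [hp : Fact (1 ≤ p)] [hq : Fact (1 ≤ q)]
    {f : Lp ℂ p (volume : Measure V)} {g : Lp ℂ q (volume : Measure V)}
    (h : (f : 𝓢'(V, ℂ)) = (g : 𝓢'(V, ℂ))) : f =ᵐ[volume] g := by
  refine ae_eq_of_integral_contDiff_smul_eq ((Lp.memLp f).locallyIntegrable hp.elim)
    ((Lp.memLp g).locallyIntegrable hq.elim) fun u hu hc => ?_
  have hc' : HasCompactSupport (Complex.ofRealCLM ∘ u) := hc.comp_left rfl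
  have hu' : ContDiff ℝ ∞ (Complex.ofRealCLM ∘ u) := by fun_prop
  have := DFunLike.congr_fun h (hc'.toSchwartzMap hu')
  rw [Lp.toTemperedDistribution_apply, Lp.toTemperedDistribution_apply] at this
  simpa using this

theorem stepLp_toTemperedDistribution {ι : Type*} [Fintype ι] (p q : ℝ≥0∞) [Fact (1 ≤ p)]
    [Fact (1 ≤ q)] {A : ι → Set V} (hA : ∀ i, MeasurableSet (A i))
    (hfin : ∀ i, (volume : Measure V) (A i) ≠ ⊤) (c : ι → ℂ) :
    (stepLp p hA hfin c : 𝓢'(V, ℂ)) = (stepLp q hA hfin c : 𝓢'(V, ℂ)) :=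
  toTemperedDistribution_congr ((coeFn_stepLp p hA hfin c).trans (coeFn_stepLp q hA hfin c).symm)

end

/-! ### The Riesz–Thorin theorem for operators on tempered distributions. -/

section

variable {V : Type*} [NormedAddCommGroup V] [InnerProductSpace ℝ V] [FiniteDimensional ℝ V]
  [MeasurableSpace V] [BorelSpace V]

/-- The bilinear form of an operator bounded from `L^2` to `L^2` and from `L^1` to `L^∞`, evaluated
on step functions. -/
theorem exists_step_representative (T : 𝓢'(V, ℂ) →L[ℂ] 𝓢'(V, ℂ)) {M1 M2 : ℝ} (hM1 : 0 ≤ M1)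
    (hM2 : 0 ≤ M2)
    (h1 : ∀ f : Lp ℂ 1 (volume : Measure V), ∃ g : Lp ℂ ⊤ (volume : Measure V),
      (g : 𝓢'(V, ℂ)) = T (f : 𝓢'(V, ℂ)) ∧ ‖g‖ ≤ M1 * ‖f‖)
    (h2 : ∀ f : Lp ℂ 2 (volume : Measure V), ∃ g : Lp ℂ 2 (volume : Measure V),
      (g : 𝓢'(V, ℂ)) = T (f : 𝓢'(V, ℂ)) ∧ ‖g‖ ≤ M2 * ‖f‖)
    {n : ℕ} {A : Fin n → Set V} (hA : ∀ i, MeasurableSet (A i))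
    (hfin : ∀ i, (volume : Measure V) (A i) ≠ ⊤) (hdisj : Pairwise (Function.onFun Disjoint A))
    (a : Fin n → ℂ) :
    ∃ G : Lp ℂ 2 (volume : Measure V), (G : 𝓢'(V, ℂ)) = T (stepLp 2 hA hfin a : 𝓢'(V, ℂ)) ∧
      MemLp G ⊤ volume ∧
      ∀ {k : ℕ} {B : Fin k → Set V} (hB : ∀ j, MeasurableSet (B j))
        (hfinB : ∀ j, (volume : Measure V) (B j) ≠ ⊤) (_ : Pairwise (Function.onFun Disjoint B))
        (b : Fin k → ℂ) {q : ℝ}, 1 ≤ q → q ≤ 2 →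
        ‖∫ x, G x * stepLp 2 hB hfinB b x‖ ≤ M2 ^ (2 - 2 / q) * M1 ^ (2 / q - 1) *
          ((∑ i, ‖a i‖ ^ q * volume.real (A i)) * ∑ j, ‖b j‖ ^ q * volume.real (B j)) ^ (1 / q) := by
  -- Fixing the images of the indicators once makes `G` linear in the coefficients, so the pairing
  -- with step functions is given by a matrix `β` independent of them, as `riesz_thorin_finite`
  -- requires.
  choose t ht htn using fun i => h2 (indicatorConstLp 2 (hA i) (hfin i) (1 : ℂ))
  let ι2 := Lp.toTemperedDistributionCLM ℂ (volume : Measure V) 2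
  let G : (Fin n → ℂ) → Lp ℂ 2 (volume : Measure V) := fun c => ∑ i, c i • t i
  have hG : ∀ c, (G c : 𝓢'(V, ℂ)) = T (stepLp 2 hA hfin c : 𝓢'(V, ℂ)) := by
    intro c
    change ι2 (∑ i, c i • t i) = T (ι2 (∑ i, c i • indicatorConstLp 2 (hA i) (hfin i) (1 : ℂ)))
    rw [map_sum, map_sum, map_sum]
    refine Finset.sum_congr rfl fun i _ => ?_
    rw [map_smul, map_smul, map_smul]
    exact congrArg (c i • ·) (ht i)
  have hG2 : ∀ c, ‖G c‖ ≤ M2 * ‖stepLp 2 hA hfin c‖ := by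
    intro c
    obtain ⟨g, hg, hgn⟩ := h2 (stepLp 2 hA hfin c)
    have : g = G c := toTemperedDistribution_injective 2 (hg.trans (hG c).symm)
    rwa [← this]
  have hG1 : ∀ c, ∃ g : Lp ℂ ⊤ (volume : Measure V), G c =ᵐ[volume] g ∧
      ‖g‖ ≤ M1 * ‖stepLp 1 hA hfin c‖ := by
    intro c
    obtain ⟨g, hg, hgn⟩ := h1 (stepLp 1 hA hfin c)
    refine ⟨g, ae_eq_of_toTemperedDistribution_eq ?_, hgn⟩
    rw [hG, hg, stepLp_toTemperedDistribution 1 2]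
  refine ⟨G a, hG a, ?_, ?_⟩
  · obtain ⟨g, hg, -⟩ := hG1 a
    exact (memLp_congr_ae hg).2 (Lp.memLp g)
  intro k B hB hfinB hdisjB b q hq1 hq2
  let Φ := (ContinuousLinearMap.mul ℂ ℂ).lpPairing (volume : Measure V) 2 2
  have hΦ : ∀ f g, Φ f g = ∫ x, f x * g x := fun f g =>
    (ContinuousLinearMap.mul ℂ ℂ).lpPairing_eq_integral f g
  let β : Fin n → Fin k → ℂ := fun i j => Φ (t i) (indicatorConstLp 2 (hB j) (hfinB j) (1 : ℂ))
  have hexp : ∀ c e, ∑ i, ∑ j, c i * e j * β i j = ∫ x, G c x * stepLp 2 hB hfinB e x := by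
    intro c e
    rw [← hΦ]
    simp only [G, stepLp, map_sum, map_smul, sum_apply,
      smul_apply, smul_eq_mul, Finset.mul_sum, β]
    rw [Finset.sum_comm]
    refine Finset.sum_congr rfl fun j _ => Finset.sum_congr rfl fun i _ => by ring
  rw [← hexp]
  refine riesz_thorin_finite _ _ (fun i => measureReal_nonneg) (fun j => measureReal_nonneg) β hM1 hM2
    ?_ ?_ hq1 hq2 a b
  · intro c e
    obtain ⟨g, hg, hgn⟩ := hG1 c
    have e1 : ∫ x, G c x * stepLp 2 hB hfinB e x = ∫ x, g x * stepLp 1 hB hfinB e x := by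
      refine integral_congr_ae ?_
      filter_upwards [hg, coeFn_stepLp 2 hB hfinB e, coeFn_stepLp 1 hB hfinB e] with x hx hx2 hx1
      rw [hx, hx2, hx1]
    rw [hexp, e1]
    refine (norm_integral_mul_le g _).trans ((mul_le_mul_of_nonneg_right hgn (norm_nonneg _)).trans ?_)
    rw [norm_stepLp_rpow one_ne_zero ENNReal.one_ne_top hA hfin hdisj,
      norm_stepLp_rpow one_ne_zero ENNReal.one_ne_top hB hfinB hdisjB]
    simp [mul_assoc]
  · intro c e
    rw [hexp]
    refine (norm_integral_mul_le (G c) _).trans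
      ((mul_le_mul_of_nonneg_right (hG2 c) (norm_nonneg _)).trans ?_)
    rw [norm_stepLp_rpow two_ne_zero ENNReal.ofNat_ne_top hA hfin hdisj,
      norm_stepLp_rpow two_ne_zero ENNReal.ofNat_ne_top hB hfinB hdisjB, ENNReal.toReal_ofNat,
      Real.mul_rpow (Finset.sum_nonneg fun i _ => by positivity)
        (Finset.sum_nonneg fun i _ => by positivity), mul_assoc]

/-- The Riesz–Thorin theorem for an operator bounded from `L^1` to `L^∞` and from `L^2` to `L^2`. -/
theorem riesz_thorin (T : 𝓢'(V, ℂ) →L[ℂ] 𝓢'(V, ℂ)) {M1 M2 : ℝ} (hM1 : 0 ≤ M1) (hM2 : 0 ≤ M2)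
    (h1 : ∀ f : Lp ℂ 1 (volume : Measure V), ∃ g : Lp ℂ ⊤ (volume : Measure V),
      (g : 𝓢'(V, ℂ)) = T (f : 𝓢'(V, ℂ)) ∧ ‖g‖ ≤ M1 * ‖f‖)
    (h2 : ∀ f : Lp ℂ 2 (volume : Measure V), ∃ g : Lp ℂ 2 (volume : Measure V),
      (g : 𝓢'(V, ℂ)) = T (f : 𝓢'(V, ℂ)) ∧ ‖g‖ ≤ M2 * ‖f‖)
    {p q : ℝ≥0∞} [Fact (1 ≤ p)] [hq1 : Fact (1 ≤ q)] (hp2 : 2 ≤ p) [hpq : p.HolderConjugate q]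
    (f : Lp ℂ q (volume : Measure V)) :
    ∃ g : Lp ℂ p (volume : Measure V), (g : 𝓢'(V, ℂ)) = T (f : 𝓢'(V, ℂ)) ∧
      ‖g‖ ≤ M2 ^ (1 - 2 * deltaExp p) * M1 ^ (2 * deltaExp p) * ‖f‖ := by
  have hinv := hpq.inv_add_inv_eq_one
  have hp0 : p ≠ 0 := (two_pos.trans_le hp2).ne'
  have hq0 : q ≠ 0 := (zero_lt_one.trans_le hq1.out).ne'
  -- At `p = ∞` the claim is `h1` itself; the duality and density arguments below use finite
  -- exponents.
  rcases eq_or_ne p ⊤ with rfl | hp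
  · have : q = 1 := by simpa using hinv
    subst this
    obtain ⟨g, hg, hgn⟩ := h1 f
    refine ⟨g, hg, ?_⟩
    simpa [deltaExp] using hgn
  have hsum : p.toReal⁻¹ + q.toReal⁻¹ = 1 := by
    have := congrArg ENNReal.toReal hinv
    rwa [ENNReal.toReal_add (ENNReal.inv_ne_top.2 hp0) (ENNReal.inv_ne_top.2 hq0), ENNReal.toReal_inv,
      ENNReal.toReal_inv, ENNReal.toReal_one] at this
  have hpr : 2 ≤ p.toReal := by
    have := (ENNReal.toReal_le_toReal (by simp) hp).2 hp2
    simpa using this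
  have hpi : p.toReal⁻¹ ≤ 2⁻¹ := inv_anti₀ two_pos hpr
  have hpi0 : 0 < p.toReal⁻¹ := by positivity
  have hqt : q ≠ ⊤ := by
    rintro rfl
    simp at hsum
    linarith
  have hqr0 : 0 < q.toReal := ENNReal.toReal_pos hq0 hqt
  have hqr1 : 1 ≤ q.toReal := by
    by_contra! h
    have := (one_lt_inv₀ hqr0).2 h
    linarith
  have hqr2 : q.toReal ≤ 2 := by
    by_contra! h
    have := (inv_lt_inv₀ hqr0 two_pos).2 h
    linarith
  have hδ1 : 2 * deltaExp p = 2 / q.toReal - 1 := by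
    rw [deltaExp, ENNReal.toReal_inv, div_eq_mul_inv 2 q.toReal]; linarith
  have hδ2 : 1 - 2 * deltaExp p = 2 - 2 / q.toReal := by rw [hδ1]; ring
  rw [hδ2, hδ1]
  refine exists_Lp_representative_of_dense T (Lp.simpleFunc ℂ q volume) (Lp.simpleFunc.dense hqt) ?_ f
  intro f' hf'
  obtain ⟨n, A, hA, hfin, a, hdisj, hf⟩ := exists_eq_stepLp hq0 hqt (⟨f', hf'⟩ : Lp.simpleFunc ℂ q volume)
  change f' = _ at hf
  obtain ⟨G, hG, hGt, hGb⟩ := exists_step_representative T hM1 hM2 h1 h2 hA hfin hdisj a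
  -- Membership in `L^p` must be known before duality can estimate the norm; it holds because `G` is
  -- in `L²` and `L^∞`.
  have hmem : MemLp G p volume := memLp_of_memLp_two_of_memLp_top (Lp.memLp G) hGt hp2 hp
  refine ⟨hmem.toLp G, ?_, ?_⟩
  · rw [hf, stepLp_toTemperedDistribution q 2, ← hG]
    exact toTemperedDistribution_congr hmem.coeFn_toLp
  · refine norm_le_of_integral_mul_simpleFunc_le (p := p) (q := q)
      (lt_of_lt_of_le ENNReal.one_lt_two hp2) hp _ (by positivity) fun h => ?_
    obtain ⟨k, B, hB, hfinB, b, hdisjB, hh⟩ := exists_eq_stepLp hq0 hqt h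
    have e1 : ∫ x, hmem.toLp G x * (h : Lp ℂ q volume) x = ∫ x, G x * stepLp 2 hB hfinB b x := by
      refine integral_congr_ae ?_
      rw [hh]
      filter_upwards [hmem.coeFn_toLp, coeFn_stepLp 2 hB hfinB b, coeFn_stepLp q hB hfinB b]
        with x hx hx2 hx1
      rw [hx, hx2, hx1]
    rw [e1]
    refine (hGb hB hfinB hdisjB b hqr1 hqr2).trans (le_of_eq ?_)
    rw [hf, hh, norm_stepLp_rpow hq0 hqt hA hfin hdisj, norm_stepLp_rpow hq0 hqt hB hfinB hdisjB,
      Real.mul_rpow (Finset.sum_nonneg fun i _ => by positivity)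
        (Finset.sum_nonneg fun i _ => by positivity), mul_assoc, mul_assoc, mul_assoc]

end

/-! ### Assembling the estimate. -/

section

variable {d : ℕ}

theorem exists_norm_dyadicSymbol_le {ψ : Space d → ℝ} (hψ : IsRadialBump ψ) :
    ∃ B : ℝ, 1 ≤ B ∧ ∀ j ξ, ‖dyadicSymbol ψ j ξ‖ ≤ B := by
  obtain ⟨B0, h0⟩ := (hasCompactSupport_dyadicProfile hψ 0).exists_bound_of_continuous
    (contDiff_dyadicProfile hψ 0).continuous
  obtain ⟨B1, h1⟩ := (hasCompactSupport_dyadicProfile hψ 1).exists_bound_of_continuous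
    (contDiff_dyadicProfile hψ 1).continuous
  refine ⟨max 1 (max B0 B1), le_max_left _ _, fun j ξ => ?_⟩
  rw [dyadicSymbol_eq]
  rcases Nat.eq_zero_or_pos j with rfl | hj
  · exact (h0 _).trans ((le_max_left _ _).trans (le_max_right _ _))
  · have e : dyadicProfile ψ j = dyadicProfile ψ 1 := by
      simp [dyadicProfile, hj.ne']
    rw [e]
    exact (h1 _).trans ((le_max_right _ _).trans (le_max_right _ _))

theorem norm_propagatorSymbol (lam t : ℝ) (ξ : Space d) : ‖propagatorSymbol lam t ξ‖ = 1 := by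
  rw [propagatorSymbol, mul_comm, Complex.norm_exp_ofReal_mul_I]

theorem hasTemperateGrowth_blockSymbol {ψ : Space d → ℝ} (hψ : IsRadialBump ψ) (j : ℕ) {lam : ℝ}
    (hl : 0 < lam) (t : ℝ) : (blockSymbol ψ j lam t).HasTemperateGrowth :=
  (hasTemperateGrowth_dyadicSymbol hψ j).mul (hasTemperateGrowth_propagatorSymbol hl t)

theorem integrable_blockSymbol {ψ : Space d → ℝ} (hψ : IsRadialBump ψ) (j : ℕ) {lam : ℝ}
    (hl : 0 < lam) (t : ℝ) : Integrable (blockSymbol ψ j lam t) := by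
  refine (hasTemperateGrowth_blockSymbol hψ j hl t).1.continuous.integrable_of_hasCompactSupport ?_
  refine HasCompactSupport.mul_right ?_
  have h1 : HasCompactSupport fun ξ : Space d => dyadicSymbol ψ j ((2 * Real.pi) • ξ) := by
    simp_rw [dyadicSymbol_eq]
    have h2 := (hasCompactSupport_dyadicProfile hψ j).comp_smul
      (c := ((2 : ℝ) ^ j)⁻¹ * (2 * Real.pi)) (by positivity)
    simpa only [mul_smul] using h2
  exact h1.comp_left (g := Complex.ofReal) Complex.ofReal_zero

theorem dyadicBlock_propagator {ψ : Space d → ℝ} (hψ : IsRadialBump ψ) (j : ℕ) {lam : ℝ}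
    (hl : 0 < lam) (t : ℝ) (u : 𝓢'(Space d, ℂ)) :
    dyadicBlock ψ j (propagator lam t u) =
      TemperedDistribution.fourierMultiplierCLM ℂ (blockSymbol ψ j lam t) u := by
  rw [dyadicBlock, propagator, multiplier, multiplier,
    TemperedDistribution.fourierMultiplierCLM_fourierMultiplierCLM_apply
      (hasTemperateGrowth_propagatorSymbol hl t) (hasTemperateGrowth_dyadicSymbol hψ j)]
  congr 2
  ext ξ
  simp only [blockSymbol, Pi.mul_apply]
  ring

theorem deltaExp_nonneg {p : ℝ≥0∞} (hp : 2 ≤ p) : 0 ≤ deltaExp p := by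
  have h1 : p⁻¹ ≤ 2⁻¹ := ENNReal.inv_le_inv.2 hp
  have h2 := (ENNReal.toReal_le_toReal (h1.trans_lt (by simp)).ne (by simp)).2 h1
  rw [ENNReal.toReal_inv 2, ENNReal.toReal_ofNat] at h2
  rw [deltaExp]
  linarith

theorem deltaExp_le_half (p : ℝ≥0∞) : 2 * deltaExp p ≤ 1 := by
  have := ENNReal.toReal_nonneg (a := p⁻¹)
  rw [deltaExp]
  linarith

/-- Used with `k = 2δ(p)`: `x ↦ x ^ k` is subadditive for `0 ≤ k ≤ 1`, and `B ≥ 1` together with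
`max 1 C` makes the constant independent of `k`. -/
theorem rpow_mul_rpow_add_le {B C T X Y k : ℝ} (hB : 1 ≤ B) (hC : 0 ≤ C) (hT : 0 ≤ T) (hX : 0 ≤ X)
    (hY : 0 ≤ Y) (hk0 : 0 ≤ k) (hk1 : k ≤ 1) :
    B ^ (1 - k) * (C * T * (X + Y)) ^ k ≤ B * max 1 C * T ^ k * (X ^ k + Y ^ k) := by
  rw [Real.mul_rpow (by positivity) (by positivity), Real.mul_rpow hC hT]
  have h1 : B ^ (1 - k) ≤ B := by
    simpa using Real.rpow_le_rpow_of_exponent_le hB (show 1 - k ≤ 1 by linarith)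
  have h2 : C ^ k ≤ max 1 C :=
    calc C ^ k ≤ max 1 C ^ k := Real.rpow_le_rpow hC (le_max_right _ _) hk0
      _ ≤ max 1 C := by
        simpa using Real.rpow_le_rpow_of_exponent_le (le_max_left 1 C) hk1
  have h3 : (X + Y) ^ k ≤ X ^ k + Y ^ k := Real.rpow_add_le_add_rpow hX hY hk0 hk1
  calc _ = B ^ (1 - k) * C ^ k * T ^ k * (X + Y) ^ k := by ring
    _ ≤ _ := by gcongr

end

end KleinGordon

theorem lemma3p4 (d : ℕ) (hd : 1 ≤ d) (ψ : KleinGordon.Space d → ℝ)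
    (hψ : KleinGordon.IsRadialBump ψ) :
    ∃ C : ℝ, ∀ (p p' : ℝ≥0∞) [Fact (1 ≤ p)] [Fact (1 ≤ p')], 2 ≤ p → p.HolderConjugate p' →
      ∀ θ : ℝ, 0 ≤ θ → θ ≤ 1 → ∀ lam : ℝ, 1 < lam → ∀ t : ℝ, t ≠ 0 →
      ∀ (j : ℕ) (f : MeasureTheory.Lp ℂ p' (MeasureTheory.volume : MeasureTheory.Measure (KleinGordon.Space d))),
      ∃ g : MeasureTheory.Lp ℂ p (MeasureTheory.volume : MeasureTheory.Measure (KleinGordon.Space d)),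
        (g : 𝓢'(KleinGordon.Space d, ℂ)) =
          KleinGordon.dyadicBlock ψ j
            (KleinGordon.propagator lam t (f : 𝓢'(KleinGordon.Space d, ℂ))) ∧
        ‖g‖ ≤ C * |t| ^ (-(((d : ℝ) - 1 + θ) * KleinGordon.deltaExp p)) *
          (lam ^ (((d : ℝ) - 1 + θ) * KleinGordon.deltaExp p) *
              (2 : ℝ) ^ (2 * (j : ℝ) * (1 - θ) * KleinGordon.deltaExp p) +
            lam ^ (-(2 * θ * KleinGordon.deltaExp p)) *
              (2 : ℝ) ^ ((j : ℝ) * ((d : ℝ) + 1 + θ) * KleinGordon.deltaExp p)) * ‖f‖ := by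
  open KleinGordon in
  obtain ⟨C, hC, hker⟩ := exists_norm_fourierInv_blockSymbol_le hd hψ
  obtain ⟨B, hB, hsym⟩ := exists_norm_dyadicSymbol_le hψ
  refine ⟨B * max 1 C, fun p p' _ _ hp2 hpp θ hθ0 hθ1 lam hlam t ht j f => ?_⟩
  have hl : 0 < lam := by linarith
  have ht' : 0 < |t| := abs_pos.2 ht
  have hm := hasTemperateGrowth_blockSymbol hψ j hl t
  set X : ℝ := lam ^ (((d : ℝ) - 1 + θ) / 2) * ((2 : ℝ) ^ j) ^ (1 - θ) with hX
  set Y : ℝ := lam ^ (-θ) * ((2 : ℝ) ^ j) ^ (((d : ℝ) + 1 + θ) / 2) with hY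
  have hX0 : 0 ≤ X := by positivity
  have hY0 : 0 ≤ Y := by positivity
  obtain ⟨g, hg, hgn⟩ := riesz_thorin
    (TemperedDistribution.fourierMultiplierCLM ℂ (blockSymbol ψ j lam t))
    (M1 := C * |t| ^ (-(((d : ℝ) - 1 + θ) / 2)) * (X + Y)) (M2 := B) (by positivity) (by linarith)
    (exists_Linfty_representative hm (integrable_blockSymbol hψ j hl t)
      (hker θ hθ0 hθ1 lam hlam t ht j))
    (exists_L2_representative hm fun ξ => by
      rw [blockSymbol, norm_mul, norm_propagatorSymbol, mul_one, Complex.norm_real]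
      exact hsym j _)
    (p := p) hp2 f
  refine ⟨g, by rw [hg, dyadicBlock_propagator hψ j hl], hgn.trans ?_⟩
  -- The kernel exponents are those of the theorem at `δ = 1/2`; raising to the power `2δ(p)` gives
  -- the general ones.
  refine mul_le_mul_of_nonneg_right ((rpow_mul_rpow_add_le hB hC.le (by positivity) hX0 hY0
    (mul_nonneg two_pos.le (deltaExp_nonneg hp2)) (deltaExp_le_half p)).trans (le_of_eq ?_))
    (norm_nonneg _)
  have h2 : (0 : ℝ) ≤ 2 ^ j := by positivity
  rw [hX, hY, Real.mul_rpow (by positivity) (by positivity),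
    Real.mul_rpow (by positivity) (by positivity), ← Real.rpow_mul ht'.le, ← Real.rpow_mul hl.le,
    ← Real.rpow_mul hl.le, ← Real.rpow_mul h2, ← Real.rpow_mul h2, ← Real.rpow_natCast,
    ← Real.rpow_mul two_pos.le, ← Real.rpow_mul two_pos.le]
  ring_nf
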